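/- **Theorem (Cut-elimination).** Let $\Gamma,\Phi_1,\dots,\Phi_n\vdash\Delta$ be a canonical sequent such that no negation occurs in the body of any definitional rule of any definition $\Phi_i$. If $\Gamma,\Phi_1,\dots,\Phi_n\vdash\Delta$ is provable in the sequent calculus $\mathrm{SC}_{\mathrm{FO(ID)}}$, then it is provable in $\mathrm{SC}_{\mathrm{FO(ID)}}$ without the rule (cut). The notions are the following. *Syntax.* The vocabulary consists of predicate symbols and function symbols with arities, among them infinitely many object symbols (nullary function symbols), which may be quantified. Atoms are $\top$, $\bot$, $t=s$ and $P(\bar t)$; FO-formulas are built from atoms with $\neg,\wedge,\vee,\Rightarrow,\Leftrightarrow,\forall,\exists$. A definitional rule is an expression $\forall\bar x: P(\bar t)\leftarrow\varphi$ whose body $\varphi$ is an FO-formula. A definition $\Phi$ is a finite set of definitional rules; $\mathrm{def}(\Phi)$ is the set of predicate symbols that occur in heads of rules of $\Phi$ (the defined predicates), and $\mathrm{par}(\Phi)$ is the set of all other non-logical symbols that occur in $\Phi$. FO(ID)-formulas are built from atoms and definitions with the same connectives and quantifiers. Expressions that differ only in the names of bound object symbols are identified, and substitution is capture-avoiding.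 A sequent $\Gamma\vdash\Delta$ consists of two sets of FO(ID)-formulas. *Canonical sequents.* $\Gamma,\Phi_1,\dots,\Phi_n\vdash\Delta$ is canonical if $\Gamma$ and $\Delta$ are finite sets of FO-formulas, $\Phi_1,\dots,\Phi_n$ are definitions, the body of every rule of every $\Phi_i$ is composed of literals (atoms and negated atoms) by conjunctions and disjunctions, $\mathrm{def}(\Phi_i)\cap\mathrm{def}(\Phi_j)=\emptyset$ for $i\neq j$, and $\mathrm{def}(\Phi_i)\cap\mathrm{par}(\Phi_j)=\emptyset$ for $j<i$. *Calculus.* A proof is a finite tree of sequents built with the following rules, for FO(ID)-formulas $\varphi,\psi$ and terms $t,s$ (commas denote unions of sets). - (ax) $\Gamma\vdash\Delta$ if $\Gamma\cap\Delta\ne\emptyset$ or $\bot\in\Gamma$ or $\top\in\Delta$. (wk) From $\Gamma'\vdash\Delta'$ infer $\Gamma\vdash\Delta$ if $\Gamma'\subseteq\Gamma$ and $\Delta'\subseteq\Delta$. (subst) From $\Gamma\vdash\Delta$ infer $\Gamma[t/x]\vdash\Delta[t/x]$. (cut) From $\Gamma\vdash\varphi,\Delta$ and $\Gamma,\varphi\vdash\Delta$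 infer $\Gamma\vdash\Delta$. - ($\neg$L) From $\Gamma\vdash\varphi,\Delta$ infer $\Gamma,\neg\varphi\vdash\Delta$. ($\neg$R) From $\Gamma,\varphi\vdash\Delta$ infer $\Gamma\vdash\neg\varphi,\Delta$. - ($\vee$L) From $\Gamma,\varphi\vdash\Delta$ and $\Gamma,\psi\vdash\Delta$ infer $\Gamma,\varphi\vee\psi\vdash\Delta$. ($\vee$R) From $\Gamma\vdash\varphi,\psi,\Delta$ infer $\Gamma\vdash\varphi\vee\psi,\Delta$. - ($\wedge$L) From $\Gamma,\varphi,\psi\vdash\Delta$ infer $\Gamma,\varphi\wedge\psi\vdash\Delta$. ($\wedge$R) From $\Gamma\vdash\varphi,\Delta$ and $\Gamma\vdash\psi,\Delta$ infer $\Gamma\vdash\varphi\wedge\psi,\Delta$. - ($\Rightarrow$L) From $\Gamma\vdash\varphi,\Delta$ and $\Gamma,\psi\vdash\Delta$ infer $\Gamma,\varphi\Rightarrow\psi\vdash\Delta$. ($\Rightarrow$R) From $\Gamma,\varphi\vdash\psi,\Delta$ infer $\Gamma\vdash\varphi\Rightarrow\psi,\Delta$. - ($\Leftrightarrow$L) From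 $\Gamma\vdash\varphi,\psi,\Delta$ and $\Gamma,\varphi,\psi\vdash\Delta$ infer $\Gamma,\varphi\Leftrightarrow\psi\vdash\Delta$. ($\Leftrightarrow$R) From $\Gamma,\varphi\vdash\psi,\Delta$ and $\Gamma,\psi\vdash\varphi,\Delta$ infer $\Gamma\vdash\varphi\Leftrightarrow\psi,\Delta$. - ($\forall$L) From $\Gamma,\varphi[t/x]\vdash\Delta$ infer $\Gamma,\forall x:\varphi\vdash\Delta$. ($\forall$R) From $\Gamma\vdash\varphi,\Delta$ infer $\Gamma\vdash\forall x:\varphi,\Delta$ if $x$ is not free in $\Gamma\cup\Delta$. ($\exists$L) From $\Gamma,\varphi\vdash\Delta$ infer $\Gamma,\exists x:\varphi\vdash\Delta$ if $x$ is not free in $\Gamma\cup\Delta$. ($\exists$R) From $\Gamma\vdash\varphi[t/x],\Delta$ infer $\Gamma\vdash\exists x:\varphi,\Delta$. - ($=$L) From $\Gamma[s/x,t/y]\vdash\Delta[s/x,t/y]$ infer $\Gamma[t/x,s/y],\,t=s\vdash\Delta[t/x,s/y]$, where $x\neq y$. ($=$R) $\Gamma\vdash t=t,\Delta$. - (def R)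 From $\Gamma,\Phi\vdash\varphi[\bar s/\bar x],\Delta$ infer $\Gamma,\Phi\vdash P(\bar t[\bar s/\bar x]),\Delta$, where $\forall\bar x:P(\bar t)\leftarrow\varphi$ is a rule of the definition $\Phi$ and $\bar s$ is a tuple of terms. - (def L) Choose $\Pi\subseteq\mathrm{def}(\Phi)$ with $P\in\Pi$ and, for each $Q\in\Pi$, an FO-formula $F_Q$ with a tuple $\bar z$ of distinct object symbols, writing $F_Q[\bar u]$ for $F_Q[\bar u/\bar z]$. From the minor premises $\Gamma,\Phi,\psi[F_\Pi/\Pi^+]\vdash F_Q[\bar s],\Delta$, one for each rule $\forall\bar y:Q(\bar s)\leftarrow\psi$ of $\Phi$ with $Q\in\Pi$, and the major premise $\Gamma,\Phi,F_P[\bar v]\vdash\Delta$, infer $\Gamma,\Phi,P(\bar v)\vdash\Delta$. Here the bound symbols $\bar y$ of each rule are named by distinct object symbols that are not free in $\Gamma,\Delta,\Phi$ nor (apart from $\bar z$) in the formulas $F_R$, $R\in\Pi$, and $\psi[F_\Pi/\Pi^+]$ results from $\psi$ by replacing each positive occurrence of an atom $R(\bar u)$ with $R\in\Pi$ by $F_R[\bar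 u]$. An occurrence is positive if it lies in the scope of an even number of negations, after $\Leftrightarrow$ and $\Rightarrow$ are unwound in terms of $\wedge,\vee,\neg$. -/

import Mathlib

universe u v w d

namespace FOID

/-! ## Terms

A vocabulary is given by a first-order language `L`, which provides the predicate symbols and the
function symbols, together with a type `X` of object symbols (the nullary function symbols).
Free object symbols are elements of `X`. Bound occurrences of object symbols are represented
by de Bruijn levels, elements of `Fin n`, so that expressions that differ only in the names of their
bound symbols are identified and every substitution is capture-avoiding. Nullary function symbols
of `L` itself, if there are any, are additional constants that are never bound. -/

/-- Terms in the scope of `n` bound object symbols. -/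
abbrev Tm (L : FirstOrder.Language.{u, v}) (X : Type w) (n : ℕ) : Type max u w := L.Term (X ⊕ Fin n)

/-- Predicate symbols, together with their arity. -/
abbrev Pred (L : FirstOrder.Language.{u, v}) : Type v := Σ k, L.Relations k

variable {L : FirstOrder.Language.{u, v}} {X : Type w}

/-- The object symbols that occur freely in a term. -/
def Tm.free {n : ℕ} : Tm L X n → Set X
  | .var (.inl x) => {x}
  | .var (.inr _) => ∅
  | .func _ ts => {x | ∃ i, x ∈ Tm.free (ts i)}

/-- The free object symbol `x` as a term. -/
def obj {n : ℕ} (x : X) : Tm L X n := .var (.inl x)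

/-- The bound object symbol `i` as a term. -/
def bd {n : ℕ} (i : Fin n) : Tm L X n := .var (.inr i)

/-- A simultaneous substitution: a term for every free object symbol and for every one of the `m`
bound object symbols in scope. -/
abbrev Sub (L : FirstOrder.Language.{u, v}) (X : Type w) (m n : ℕ) : Type max u w := X ⊕ Fin m → Tm L X n

/-- Weakening of a term to a scope with `k` more bound object symbols. -/
def Tm.weaken {n : ℕ} (k : ℕ) (t : Tm L X n) : Tm L X (n + k) :=
  t.relabel (Sum.map id (Fin.castAdd k))

/-- The substitution `σ` in the scope of `k` more binders, whose bound symbols it leaves alone. -/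
def Sub.lift {m n : ℕ} (k : ℕ) (σ : Sub L X m n) : Sub L X (m + k) (n + k)
  | .inl x => (σ (.inl x)).weaken k
  | .inr i => Fin.addCases (fun j => (σ (.inr j)).weaken k) (fun j => bd (Fin.natAdd n j)) i

/-- Replaces the innermost `m` bound object symbols by the terms `s`. -/
def Sub.inst {n m : ℕ} (s : Fin m → Tm L X n) : Sub L X (n + m) n
  | .inl x => obj x
  | .inr i => Fin.addCases bd s i

/-- Replaces all `m` bound object symbols by the terms `s`. -/
def Sub.args {n m : ℕ} (s : Fin m → Tm L X n) : Sub L X m n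
  | .inl x => obj x
  | .inr i => s i

open Classical in
/-- The substitution `[t / x]`. -/
noncomputable def Sub.single {n : ℕ} (x : X) (t : Tm L X n) : Sub L X n n
  | .inl z => if z = x then t else obj z
  | .inr i => bd i

open Classical in
/-- The simultaneous substitution `[t / x, s / y]`. -/
noncomputable def Sub.double {n : ℕ} (x : X) (t : Tm L X n) (y : X) (s : Tm L X n) : Sub L X n n
  | .inl z => if z = x then t else if z = y then s else obj z
  | .inr i => bd i

/-! ## Formulas and definitions -/

/-- Formulas in the scope of `n` bound object symbols. Besides the usual atoms there are atoms taken
from the family `D`: it is empty for first-order formulas and consists of the inductive definitions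
for FO(ID)-formulas. -/
inductive Fml (L : FirstOrder.Language.{u, v}) (X : Type w) (D : ℕ → Type d) : ℕ → Type max u v w d
  | top {n : ℕ} : Fml L X D n
  | bot {n : ℕ} : Fml L X D n
  | eq {n : ℕ} (t s : Tm L X n) : Fml L X D n
  | rel {n : ℕ} (P : Pred L) (ts : Fin P.1 → Tm L X n) : Fml L X D n
  | defn {n : ℕ} (Φ : D n) : Fml L X D n
  | neg {n : ℕ} (φ : Fml L X D n) : Fml L X D n
  | and {n : ℕ} (φ ψ : Fml L X D n) : Fml L X D n
  | or {n : ℕ} (φ ψ : Fml L X D n) : Fml L X D n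
  | imp {n : ℕ} (φ ψ : Fml L X D n) : Fml L X D n
  | iff {n : ℕ} (φ ψ : Fml L X D n) : Fml L X D n
  | all {n : ℕ} (φ : Fml L X D (n + 1)) : Fml L X D n
  | ex {n : ℕ} (φ : Fml L X D (n + 1)) : Fml L X D n

namespace Fml

variable {D : ℕ → Type d}

/-- Substitution in a formula, given substitution in the atoms from `D`. -/
def substWith (sD : ∀ {m n : ℕ}, Sub L X m n → D m → D n) :
    {m : ℕ} → Fml L X D m → {n : ℕ} → Sub L X m n → Fml L X D n
  | _, top, _, _ => top
  | _, bot, _, _ => bot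
  | _, eq t s, _, σ => eq (t.subst σ) (s.subst σ)
  | _, rel P ts, _, σ => rel P (fun i => (ts i).subst σ)
  | _, defn Φ, _, σ => defn (sD σ Φ)
  | _, neg φ, _, σ => neg (substWith sD φ σ)
  | _, and φ ψ, _, σ => and (substWith sD φ σ) (substWith sD ψ σ)
  | _, or φ ψ, _, σ => or (substWith sD φ σ) (substWith sD ψ σ)
  | _, imp φ ψ, _, σ => imp (substWith sD φ σ) (substWith sD ψ σ)
  | _, iff φ ψ, _, σ => iff (substWith sD φ σ) (substWith sD ψ σ)
  | _, all φ, _, σ => all (substWith sD φ (σ.lift 1))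
  | _, ex φ, _, σ => ex (substWith sD φ (σ.lift 1))

/-- The freely occurring object symbols of a formula, given those of the atoms from `D`. -/
def freeWith (fD : ∀ {n : ℕ}, D n → Set X) : {n : ℕ} → Fml L X D n → Set X
  | _, top => ∅
  | _, bot => ∅
  | _, eq t s => t.free ∪ s.free
  | _, rel _ ts => {x | ∃ i, x ∈ (ts i).free}
  | _, defn Φ => fD Φ
  | _, neg φ => freeWith fD φ
  | _, and φ ψ => freeWith fD φ ∪ freeWith fD ψ
  | _, or φ ψ => freeWith fD φ ∪ freeWith fD ψ
  | _, imp φ ψ => freeWith fD φ ∪ freeWith fD ψ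
  | _, iff φ ψ => freeWith fD φ ∪ freeWith fD ψ
  | _, all φ => freeWith fD φ
  | _, ex φ => freeWith fD φ

end Fml

/-- First-order formulas. -/
abbrev FO (L : FirstOrder.Language.{u, v}) (X : Type w) (n : ℕ) : Type max u v w :=
  Fml L X (fun _ => Empty) n

namespace FO

/-- Capture-avoiding substitution in a first-order formula. -/
def subst {m n : ℕ} (φ : FO L X m) (σ : Sub L X m n) : FO L X n :=
  Fml.substWith (fun _ e => e.elim) φ σ

/-- The object symbols that occur freely in a first-order formula. -/
def free {n : ℕ} (φ : FO L X n) : Set X := Fml.freeWith (fun e => e.elim) φ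

/-- The predicate symbols that occur in a first-order formula. -/
def preds : {n : ℕ} → FO L X n → Set (Pred L)
  | _, .top => ∅
  | _, .bot => ∅
  | _, .eq _ _ => ∅
  | _, .rel P _ => {P}
  | _, .defn e => e.elim
  | _, .neg φ => preds φ
  | _, .and φ ψ => preds φ ∪ preds ψ
  | _, .or φ ψ => preds φ ∪ preds ψ
  | _, .imp φ ψ => preds φ ∪ preds ψ
  | _, .iff φ ψ => preds φ ∪ preds ψ
  | _, .all φ => preds φ
  | _, .ex φ => preds φ

/-- No negation symbol occurs in the formula. -/
def NegFree : {n : ℕ} → FO L X n → Prop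
  | _, .top => True
  | _, .bot => True
  | _, .eq _ _ => True
  | _, .rel _ _ => True
  | _, .defn e => e.elim
  | _, .neg _ => False
  | _, .and φ ψ => NegFree φ ∧ NegFree ψ
  | _, .or φ ψ => NegFree φ ∧ NegFree ψ
  | _, .imp φ ψ => NegFree φ ∧ NegFree ψ
  | _, .iff φ ψ => NegFree φ ∧ NegFree ψ
  | _, .all φ => NegFree φ
  | _, .ex φ => NegFree φ

/-- First-order atoms. -/
inductive IsAtom {n : ℕ} : FO L X n → Prop
  | top : IsAtom .top
  | bot : IsAtom .bot
  | eq (t s : Tm L X n) : IsAtom (.eq t s)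
  | rel (P : Pred L) (ts : Fin P.1 → Tm L X n) : IsAtom (.rel P ts)

/-- The formula is composed of literals by conjunctions and disjunctions. -/
inductive IsLiteralCombination {n : ℕ} : FO L X n → Prop
  | atom {φ : FO L X n} (h : IsAtom φ) : IsLiteralCombination φ
  | negAtom {φ : FO L X n} (h : IsAtom φ) : IsLiteralCombination (.neg φ)
  | and {φ ψ : FO L X n} (hφ : IsLiteralCombination φ) (hψ : IsLiteralCombination ψ) :
      IsLiteralCombination (.and φ ψ)
  | or {φ ψ : FO L X n} (hφ : IsLiteralCombination φ) (hψ : IsLiteralCombination ψ) :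
      IsLiteralCombination (.or φ ψ)

open Classical in
/-- With `pos = true`: replaces every positive occurrence of an atom `R(u)` with `R ∈ S` by `F R [u]`.
With `pos = false`: replaces the negative occurrences instead. A biconditional, whose sides occur
both positively and negatively, is unwound into two implications. -/
noncomputable def replace (S : Set (Pred L)) (F : (R : Pred L) → FO L X R.1) :
    Bool → {n : ℕ} → FO L X n → FO L X n
  | _, _, .top => .top
  | _, _, .bot => .bot
  | _, _, .eq t s => .eq t s
  | pos, _, .rel R ts => if pos = true ∧ R ∈ S then (F R).subst (Sub.args ts) else .rel R ts
  | _, _, .defn e => e.elim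
  | pos, _, .neg φ => .neg (replace S F (!pos) φ)
  | pos, _, .and φ ψ => .and (replace S F pos φ) (replace S F pos ψ)
  | pos, _, .or φ ψ => .or (replace S F pos φ) (replace S F pos ψ)
  | pos, _, .imp φ ψ => .imp (replace S F (!pos) φ) (replace S F pos ψ)
  | pos, _, .iff φ ψ =>
      .and (.imp (replace S F (!pos) φ) (replace S F pos ψ))
        (.imp (replace S F (!pos) ψ) (replace S F pos φ))
  | pos, _, .all φ => .all (replace S F pos φ)
  | pos, _, .ex φ => .ex (replace S F pos φ)

end FO

/-- A definitional rule `∀ x₁ … xₘ : P(t) ← φ` in the scope of `n` bound object symbols, where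
`m = numVars`, `P = head`, `t = args` and `φ = body`. -/
structure DefRule (L : FirstOrder.Language.{u, v}) (X : Type w) (n : ℕ) : Type max u v w where
  numVars : ℕ
  head : Pred L
  args : Fin head.1 → Tm L X (n + numVars)
  body : FO L X (n + numVars)

namespace DefRule

/-- Capture-avoiding substitution in a definitional rule. -/
def subst {m n : ℕ} (r : DefRule L X m) (σ : Sub L X m n) : DefRule L X n where
  numVars := r.numVars
  head := r.head
  args := fun i => (r.args i).subst (σ.lift r.numVars)
  body := r.body.subst (σ.lift r.numVars)

/-- The object symbols that occur freely in a definitional rule. -/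
def free {n : ℕ} (r : DefRule L X n) : Set X :=
  {x | ∃ i, x ∈ (r.args i).free} ∪ r.body.free

end DefRule

/-- An inductive definition: a finite set of definitional rules. -/
abbrev Defn (L : FirstOrder.Language.{u, v}) (X : Type w) (n : ℕ) : Type max u v w := Finset (DefRule L X n)

namespace Defn

open Classical in
/-- Capture-avoiding substitution in a definition. -/
noncomputable def subst {m n : ℕ} (Φ : Defn L X m) (σ : Sub L X m n) : Defn L X n :=
  Finset.image (fun r => r.subst σ) Φ

/-- The object symbols that occur freely in a definition. -/
def free {n : ℕ} (Φ : Defn L X n) : Set X := {x | ∃ r ∈ Φ, x ∈ r.free}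

/-- The defined predicates of a definition. -/
def defined {n : ℕ} (Φ : Defn L X n) : Set (Pred L) := {P | ∃ r ∈ Φ, r.head = P}

/-- The predicate symbols among the parameters of a definition: those that occur in it and
are not defined by it. -/
def params {n : ℕ} (Φ : Defn L X n) : Set (Pred L) :=
  {P | ∃ r ∈ Φ, P ∈ r.body.preds} \ Φ.defined

end Defn

/-- FO(ID)-formulas, built from atoms and definitions with connectives and quantifiers. -/
abbrev Formula (L : FirstOrder.Language.{u, v}) (X : Type w) (n : ℕ) : Type max u v w := Fml L X (Defn L X) n

namespace Formula

/-- Capture-avoiding substitution in an FO(ID)-formula. -/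
noncomputable def subst {m n : ℕ} (φ : Formula L X m) (σ : Sub L X m n) : Formula L X n :=
  Fml.substWith (fun τ Φ => Φ.subst τ) φ σ

/-- The object symbols that occur freely in an FO(ID)-formula. -/
def free {n : ℕ} (φ : Formula L X n) : Set X := Fml.freeWith (fun Φ => Φ.free) φ

end Formula

/-- A first-order formula as an FO(ID)-formula. -/
def FO.toFormula : {n : ℕ} → FO L X n → Formula L X n
  | _, .top => .top
  | _, .bot => .bot
  | _, .eq t s => .eq t s
  | _, .rel P ts => .rel P ts
  | _, .defn e => e.elim
  | _, .neg φ => .neg (toFormula φ)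
  | _, .and φ ψ => .and (toFormula φ) (toFormula ψ)
  | _, .or φ ψ => .or (toFormula φ) (toFormula ψ)
  | _, .imp φ ψ => .imp (toFormula φ) (toFormula ψ)
  | _, .iff φ ψ => .iff (toFormula φ) (toFormula ψ)
  | _, .all φ => .all (toFormula φ)
  | _, .ex φ => .ex (toFormula φ)

/-! ## The sequent calculus -/

/-- The object symbols that occur freely in a set of formulas. -/
def freeSet (Γ : Set (Formula L X 0)) : Set X := {x | ∃ φ ∈ Γ, x ∈ φ.free}

/-- The set of formulas obtained by applying a substitution to each formula of `Γ`. -/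
def substSet (Γ : Set (Formula L X 0)) (σ : Sub L X 0 0) : Set (Formula L X 0) :=
  (fun φ => φ.subst σ) '' Γ

/-- `Derivable c Γ Δ`: the sequent `Γ ⊢ Δ` has a (finite) proof, in which the rule `cut` may be used
if and only if `c` holds. The comma in the usual notation for sequents is `insert` here.

Quantified symbols have no name here, so an instance of a quantified formula at an object symbol `x`
plays the role of its matrix, and `x` has to be fresh for the quantified formula as well. -/
inductive Derivable (c : Prop) : Set (Formula L X 0) → Set (Formula L X 0) → Prop
  /- structural rules -/
  | ax {Γ Δ : Set (Formula L X 0)} (h : (Γ ∩ Δ).Nonempty ∨ .bot ∈ Γ ∨ .top ∈ Δ) : Derivable c Γ Δ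
  | wk {Γ Γ' Δ Δ' : Set (Formula L X 0)} (hΓ : Γ' ⊆ Γ) (hΔ : Δ' ⊆ Δ) (h : Derivable c Γ' Δ') :
      Derivable c Γ Δ
  | subst {Γ Δ : Set (Formula L X 0)} (x : X) (t : Tm L X 0) (h : Derivable c Γ Δ) :
      Derivable c (substSet Γ (Sub.single x t)) (substSet Δ (Sub.single x t))
  | cut {Γ Δ : Set (Formula L X 0)} (hc : c) (φ : Formula L X 0)
      (h₁ : Derivable c Γ (insert φ Δ)) (h₂ : Derivable c (insert φ Γ) Δ) : Derivable c Γ Δ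
  /- propositional rules -/
  | negL {Γ Δ : Set (Formula L X 0)} {φ : Formula L X 0} (h : Derivable c Γ (insert φ Δ)) :
      Derivable c (insert φ.neg Γ) Δ
  | negR {Γ Δ : Set (Formula L X 0)} {φ : Formula L X 0} (h : Derivable c (insert φ Γ) Δ) :
      Derivable c Γ (insert φ.neg Δ)
  | orL {Γ Δ : Set (Formula L X 0)} {φ ψ : Formula L X 0}
      (h₁ : Derivable c (insert φ Γ) Δ) (h₂ : Derivable c (insert ψ Γ) Δ) :
      Derivable c (insert (φ.or ψ) Γ) Δ
  | orR {Γ Δ : Set (Formula L X 0)} {φ ψ : Formula L X 0}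
      (h : Derivable c Γ (insert φ (insert ψ Δ))) :
      Derivable c Γ (insert (φ.or ψ) Δ)
  | andL {Γ Δ : Set (Formula L X 0)} {φ ψ : Formula L X 0}
      (h : Derivable c (insert φ (insert ψ Γ)) Δ) :
      Derivable c (insert (φ.and ψ) Γ) Δ
  | andR {Γ Δ : Set (Formula L X 0)} {φ ψ : Formula L X 0}
      (h₁ : Derivable c Γ (insert φ Δ)) (h₂ : Derivable c Γ (insert ψ Δ)) :
      Derivable c Γ (insert (φ.and ψ) Δ)
  | impL {Γ Δ : Set (Formula L X 0)} {φ ψ : Formula L X 0}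
      (h₁ : Derivable c Γ (insert φ Δ)) (h₂ : Derivable c (insert ψ Γ) Δ) :
      Derivable c (insert (φ.imp ψ) Γ) Δ
  | impR {Γ Δ : Set (Formula L X 0)} {φ ψ : Formula L X 0}
      (h : Derivable c (insert φ Γ) (insert ψ Δ)) :
      Derivable c Γ (insert (φ.imp ψ) Δ)
  | iffL {Γ Δ : Set (Formula L X 0)} {φ ψ : Formula L X 0}
      (h₁ : Derivable c Γ (insert φ (insert ψ Δ))) (h₂ : Derivable c (insert φ (insert ψ Γ)) Δ) :
      Derivable c (insert (φ.iff ψ) Γ) Δ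
  | iffR {Γ Δ : Set (Formula L X 0)} {φ ψ : Formula L X 0}
      (h₁ : Derivable c (insert φ Γ) (insert ψ Δ)) (h₂ : Derivable c (insert ψ Γ) (insert φ Δ)) :
      Derivable c Γ (insert (φ.iff ψ) Δ)
  /- quantifier rules -/
  | allL {Γ Δ : Set (Formula L X 0)} {φ : Formula L X (0 + 1)} (t : Tm L X 0)
      (h : Derivable c (insert (φ.subst (Sub.inst fun _ => t)) Γ) Δ) :
      Derivable c (insert φ.all Γ) Δ
  | allR {Γ Δ : Set (Formula L X 0)} {φ : Formula L X (0 + 1)} (x : X)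
      (hx : x ∉ freeSet (Γ ∪ Δ)) (hφ : x ∉ Formula.free φ.all)
      (h : Derivable c Γ (insert (φ.subst (Sub.inst fun _ => obj x)) Δ)) :
      Derivable c Γ (insert φ.all Δ)
  | exL {Γ Δ : Set (Formula L X 0)} {φ : Formula L X (0 + 1)} (x : X)
      (hx : x ∉ freeSet (Γ ∪ Δ)) (hφ : x ∉ Formula.free φ.ex)
      (h : Derivable c (insert (φ.subst (Sub.inst fun _ => obj x)) Γ) Δ) :
      Derivable c (insert φ.ex Γ) Δ
  | exR {Γ Δ : Set (Formula L X 0)} {φ : Formula L X (0 + 1)} (t : Tm L X 0)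
      (h : Derivable c Γ (insert (φ.subst (Sub.inst fun _ => t)) Δ)) :
      Derivable c Γ (insert φ.ex Δ)
  /- equality rules -/
  | eqL {Γ Δ : Set (Formula L X 0)} (x y : X) (hxy : x ≠ y) (t s : Tm L X 0)
      (h : Derivable c (substSet Γ (Sub.double x s y t)) (substSet Δ (Sub.double x s y t))) :
      Derivable c (insert (.eq t s) (substSet Γ (Sub.double x t y s)))
        (substSet Δ (Sub.double x t y s))
  | eqR {Γ Δ : Set (Formula L X 0)} (t : Tm L X 0) : Derivable c Γ (insert (.eq t t) Δ)
  /- introduction rules for defined atoms -/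
  | defR {Γ Δ : Set (Formula L X 0)} (Φ : Defn L X 0) (r : DefRule L X 0) (hr : r ∈ Φ)
      (s : Fin r.numVars → Tm L X 0)
      (h : Derivable c (insert (.defn Φ) Γ)
        (insert (r.body.subst (Sub.inst s)).toFormula Δ)) :
      Derivable c (insert (.defn Φ) Γ)
        (insert (.rel r.head fun i => (r.args i).subst (Sub.inst s)) Δ)
  /- The induction rule: `S` is the chosen set of defined predicates of `Φ`, `F Q` for `Q ∈ S` is the
  induction hypothesis of `Q` (its chosen tuple of object symbols being bound), and `y r` is the tuple
  of distinct names given to the quantified object symbols of the rule `r`. -/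
  | defL {Γ Δ : Set (Formula L X 0)} (Φ : Defn L X 0) (S : Set (Pred L)) (hS : S ⊆ Φ.defined)
      (F : (Q : Pred L) → FO L X Q.1) (P : Pred L) (hP : P ∈ S) (ts : Fin P.1 → Tm L X 0)
      (y : (r : DefRule L X 0) → Fin r.numVars → X)
      (hinj : ∀ r ∈ Φ, r.head ∈ S → Function.Injective (y r))
      (hfresh : ∀ r ∈ Φ, r.head ∈ S → ∀ i,
        y r i ∉ freeSet (Γ ∪ Δ) ∧ y r i ∉ Φ.free ∧ ∀ Q ∈ S, y r i ∉ (F Q).free)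
      (hminor : ∀ r ∈ Φ, r.head ∈ S →
        Derivable c
          (insert ((r.body.replace S F true).subst
            (Sub.inst fun i => obj (y r i))).toFormula (insert (.defn Φ) Γ))
          (insert ((F r.head).subst (Sub.args fun j =>
            (r.args j).subst (Sub.inst fun i => obj (y r i)))).toFormula Δ))
      (hmajor : Derivable c
        (insert ((F P).subst (Sub.args ts)).toFormula (insert (.defn Φ) Γ)) Δ) :
      Derivable c (insert (.rel P ts) (insert (.defn Φ) Γ)) Δ

/-- Provability in the sequent calculus for FO(ID). -/
def Provable (Γ Δ : Set (Formula L X 0)) : Prop := Derivable True Γ Δ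

/-- Provability without the cut rule. -/
def CutFreeProvable (Γ Δ : Set (Formula L X 0)) : Prop := Derivable False Γ Δ

/-! ## Canonical sequents -/

/-- The left side of the regular sequent `Γ, Φ₁, …, Φₙ ⊢ Δ`. -/
def antecedent {n : ℕ} (Γ : Set (FO L X 0)) (Φ : Fin n → Defn L X 0) : Set (Formula L X 0) :=
  FO.toFormula '' Γ ∪ Set.range fun i => .defn (Φ i)

/-- The right side of the regular sequent `Γ, Φ₁, …, Φₙ ⊢ Δ`. -/
def succedent (Δ : Set (FO L X 0)) : Set (Formula L X 0) := FO.toFormula '' Δ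

/-- The regular sequent `Γ, Φ₁, …, Φₙ ⊢ Δ` is canonical. -/
structure IsCanonical {n : ℕ} (Γ : Set (FO L X 0)) (Φ : Fin n → Defn L X 0)
    (Δ : Set (FO L X 0)) : Prop where
  finite_left : Γ.Finite
  finite_right : Δ.Finite
  body : ∀ i, ∀ r ∈ Φ i, FO.IsLiteralCombination r.body
  defined_disjoint : ∀ i j, i ≠ j → (Φ i).defined ∩ (Φ j).defined = ∅
  defined_not_param : ∀ i j, j < i → (Φ i).defined ∩ (Φ j).params = ∅

end FOID

/-! The argument is semantic: a sequent without a cut-free proof is refuted in a model in which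
every rule, cut included, is sound. The model is a forcing (Boolean-valued) model. Its domain is the
set of closed terms, object symbols included. Its conditions are the finite sequents over the fixed
definitions that have no cut-free proof, and larger sequents are stronger. Forcing is classical: a
formula forced densely below a condition is forced by it. All choices are made locally by
strengthening a condition, so no maximal sequent has to be built.

Soundness (`soundness`) holds for every forcing model. A definition is forced if its predicates are
closed under its rules and lie inside every family of relations, first-order definable with
parameters, that is closed under the rules. Such Henkin-style minimality is all that (def L) uses,
since the induction hypotheses there are first-order formulas.

In `canonicalModel` an atom is forced if, densely, it is derivable (`Holds`) from atoms and
equations on the left by the congruence closure and the definitional rules. Two facts carry the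
proof. By `truth`, a formula on the left of a condition is forced and one on the right is not: a
rule applied backwards to an unprovable sequent leaves an unprovable premise, that is, a stronger
condition. By `canonicalModel.forceDefn`, all definitions are forced. Closure under the rules uses
`denseBelow_holds`: a forced body without negation is densely derivable, so its head is too.
Minimality is an induction on `Holds` (`update_of_holds`). A rule step uses the assumed closure, the
defined sets being disjoint. For an atom present on the left, `update_of_mem` applies (def L)
backwards: if the atom escaped the closed family, all premises would have cut-free proofs, and so
would the condition.

If the given sequent had no cut-free proof it would be a condition that forces its left side and
refutes its right side, against soundness. -/

namespace FOID

variable {L : FirstOrder.Language.{u, v}} {X : Type w}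

/-! ## Substitution -/

/-- First `σ`, then `τ`. -/
def Sub.comp {m n k : ℕ} (σ : Sub L X m n) (τ : Sub L X n k) : Sub L X m k := fun z => (σ z).subst τ

/-- The substitution `σ`, extended by the terms `a` for the innermost `k` bound object symbols. -/
def Sub.ext {m n k : ℕ} (σ : Sub L X m n) (a : Fin k → Tm L X n) : Sub L X (m + k) n :=
  Sum.elim (fun x => σ (.inl x)) (Fin.addCases (fun i => σ (.inr i)) a)

/-- The identity substitution. -/
def Sub.one (L : FirstOrder.Language.{u, v}) (X : Type w) (n : ℕ) : Sub L X n n := fun z => .var z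

namespace Tm

theorem subst_congr {m n : ℕ} {σ τ : Sub L X m n} (hb : ∀ i, σ (.inr i) = τ (.inr i)) :
    ∀ {t : Tm L X m}, (∀ x ∈ t.free, σ (.inl x) = τ (.inl x)) → t.subst σ = t.subst τ
  | .var (.inl x), h => h x (by simp [Tm.free])
  | .var (.inr i), _ => hb i
  | .func f ts, h => by
    simp only [FirstOrder.Language.Term.subst]
    congr 1
    funext i
    exact subst_congr hb fun x hx => h x (by simp only [Tm.free]; exact ⟨i, hx⟩)

theorem subst_subst {m n k : ℕ} (σ : Sub L X m n) (τ : Sub L X n k) :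
    ∀ t : Tm L X m, (t.subst σ).subst τ = t.subst (σ.comp τ)
  | .var _ => rfl
  | .func f ts => by
    simp only [FirstOrder.Language.Term.subst]
    congr 1
    funext i
    exact subst_subst σ τ (ts i)

theorem subst_one {n : ℕ} : ∀ t : Tm L X n, t.subst (Sub.one L X n) = t
  | .var _ => rfl
  | .func f ts => by
    simp only [FirstOrder.Language.Term.subst]
    congr 1
    funext i
    exact subst_one (ts i)

theorem weaken_eq_subst {n : ℕ} (k : ℕ) :
    ∀ t : Tm L X n, t.weaken k = t.subst fun z => .var (Sum.map id (Fin.castAdd k) z)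
  | .var _ => rfl
  | .func f ts => by
    simp only [FirstOrder.Language.Term.subst, Tm.weaken, FirstOrder.Language.Term.relabel]
    congr 1
    funext i
    exact weaken_eq_subst k (ts i)

theorem finite_free {n : ℕ} : ∀ t : Tm L X n, t.free.Finite
  | .var (.inl x) => by simp [Tm.free]
  | .var (.inr i) => by simp [Tm.free]
  | .func f ts => by
    have : Tm.free (.func f ts) = ⋃ i, Tm.free (ts i) := by
      ext x
      simp only [Tm.free, Set.mem_ofPred_eq, Set.mem_iUnion]
    rw [this]
    exact Set.finite_iUnion fun i => finite_free (ts i)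

end Tm

namespace Sub

variable {m n k l : ℕ}

/-- The weakening performed by `lift` is undone by the extension, which discards nothing but the
fresh symbols it weakened past. This identity lets substitution commute with the quantifier clauses
of forcing, where the assignment is extended by a term. -/
theorem lift_comp_ext (σ : Sub L X m n) (τ : Sub L X n l) (a : Fin k → Tm L X l) :
    (σ.lift k).comp (τ.ext a) = (σ.comp τ).ext a := by
  funext z
  rcases z with x | i
  · simp only [comp, lift, ext, Tm.weaken_eq_subst, Tm.subst_subst, Sum.elim_inl]
    congr 1
    funext z
    rcases z with x | i <;> simp [comp, FirstOrder.Language.Term.subst]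
  · induction i using Fin.addCases with
    | left i =>
      simp only [comp, lift, ext, Tm.weaken_eq_subst, Tm.subst_subst, Sum.elim_inr,
        Fin.addCases_left]
      congr 1
      funext z
      rcases z with x | i <;> simp [comp, FirstOrder.Language.Term.subst]
    | right i => simp [comp, lift, ext, bd, FirstOrder.Language.Term.subst]

theorem lift_eq_ext (σ : Sub L X m n) (k : ℕ) :
    σ.lift k = Sub.ext (fun z => (σ z).weaken k) (fun j => bd (Fin.natAdd n j)) := by
  funext z
  rcases z with x | i <;> rfl

theorem lift_comp_lift (σ : Sub L X m n) (τ : Sub L X n l) :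
    (σ.lift k).comp (τ.lift k) = (σ.comp τ).lift k := by
  rw [lift_eq_ext τ, lift_comp_ext, lift_eq_ext]
  congr 1
  funext z
  simp only [comp, Tm.weaken_eq_subst, Tm.subst_subst]
  rfl

theorem inst_comp (s : Fin k → Tm L X n) (τ : Sub L X n l) :
    (Sub.inst s).comp τ = τ.ext fun i => (s i).subst τ := by
  funext z
  rcases z with x | i
  · rfl
  · induction i using Fin.addCases <;>
      simp [comp, ext, inst, bd, FirstOrder.Language.Term.subst]

theorem args_comp (s : Fin m → Tm L X n) (τ : Sub L X n l) :
    (Sub.args s).comp τ = Sum.elim (fun x => τ (.inl x)) fun i => (s i).subst τ := by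
  funext z
  rcases z with x | i <;> rfl

theorem inst_eq_ext (s : Fin k → Tm L X n) : Sub.inst s = (Sub.one L X n).ext s := by
  funext z
  rcases z with x | i <;> rfl

theorem lift_one : (Sub.one L X n).lift k = Sub.one L X (n + k) := by
  funext z
  rcases z with x | i
  · rfl
  · induction i using Fin.addCases <;>
      simp [lift, one, bd, Tm.weaken, FirstOrder.Language.Term.relabel]

theorem lift_congr {σ τ : Sub L X m n} (k : ℕ) {s : Set X}
    (hf : ∀ x ∈ s, σ (.inl x) = τ (.inl x)) (hb : ∀ i, σ (.inr i) = τ (.inr i)) :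
    (∀ x ∈ s, σ.lift k (.inl x) = τ.lift k (.inl x)) ∧
      ∀ i, σ.lift k (.inr i) = τ.lift k (.inr i) := by
  refine ⟨fun x hx => by simp [lift, hf x hx], fun i => ?_⟩
  induction i using Fin.addCases <;> simp [lift, hb]

theorem lift_comp_inst (σ : Sub L X m n) (a : Fin k → Tm L X n) :
    (σ.lift k).comp (Sub.inst a) = σ.ext a := by
  rw [inst_eq_ext, lift_comp_ext]
  congr 1
  funext z
  exact Tm.subst_one _

end Sub

namespace FO

variable {m n k : ℕ}

@[simp] theorem subst_top (σ : Sub L X m n) : FO.subst .top σ = .top := rfl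
@[simp] theorem subst_bot (σ : Sub L X m n) : FO.subst .bot σ = .bot := rfl
@[simp] theorem subst_eq (t s) (σ : Sub L X m n) :
    FO.subst (.eq t s) σ = .eq (t.subst σ) (s.subst σ) := rfl
@[simp] theorem subst_rel (P : Pred L) (ts) (σ : Sub L X m n) :
    FO.subst (.rel P ts) σ = .rel P fun i => (ts i).subst σ := rfl
@[simp] theorem subst_neg (φ : FO L X m) (σ : Sub L X m n) : FO.subst (.neg φ) σ = .neg (φ.subst σ) := rfl
@[simp] theorem subst_and (φ ψ : FO L X m) (σ : Sub L X m n) :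
    FO.subst (.and φ ψ) σ = .and (φ.subst σ) (ψ.subst σ) := rfl
@[simp] theorem subst_or (φ ψ : FO L X m) (σ : Sub L X m n) :
    FO.subst (.or φ ψ) σ = .or (φ.subst σ) (ψ.subst σ) := rfl
@[simp] theorem subst_imp (φ ψ : FO L X m) (σ : Sub L X m n) :
    FO.subst (.imp φ ψ) σ = .imp (φ.subst σ) (ψ.subst σ) := rfl
@[simp] theorem subst_iff (φ ψ : FO L X m) (σ : Sub L X m n) :
    FO.subst (.iff φ ψ) σ = .iff (φ.subst σ) (ψ.subst σ) := rfl
@[simp] theorem subst_all (φ : FO L X (m + 1)) (σ : Sub L X m n) :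
    FO.subst (.all φ) σ = .all (φ.subst (σ.lift 1)) := rfl
@[simp] theorem subst_ex (φ : FO L X (m + 1)) (σ : Sub L X m n) :
    FO.subst (.ex φ) σ = .ex (φ.subst (σ.lift 1)) := rfl

theorem subst_subst (φ : FO L X m) : ∀ {n k} (σ : Sub L X m n) (τ : Sub L X n k),
    (φ.subst σ).subst τ = φ.subst (σ.comp τ) := by
  induction φ with
  | defn e => exact e.elim
  | _ => intros; simp_all [Tm.subst_subst, Sub.lift_comp_lift]

end FO

namespace Fml

variable {D : ℕ → Type d}

/-- The atoms from `D` enter only through `hD`. The result is needed twice: with no such atoms for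
rule bodies, and then for FO(ID)-formulas, whose atoms are definitions containing those bodies. -/
theorem substWith_congr (sD : ∀ {m n : ℕ}, Sub L X m n → D m → D n) (fD : ∀ {n : ℕ}, D n → Set X)
    (hD : ∀ {m n : ℕ} (σ τ : Sub L X m n) (Φ : D m), (∀ x ∈ fD Φ, σ (.inl x) = τ (.inl x)) →
      (∀ i, σ (.inr i) = τ (.inr i)) → sD σ Φ = sD τ Φ) {m : ℕ} (φ : Fml L X D m) :
    ∀ {n : ℕ} (σ τ : Sub L X m n), (∀ x ∈ φ.freeWith fD, σ (.inl x) = τ (.inl x)) →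
      (∀ i, σ (.inr i) = τ (.inr i)) → φ.substWith sD σ = φ.substWith sD τ := by
  induction φ with
  | top => intros; rfl
  | bot => intros; rfl
  | eq t s =>
    intro n σ τ hf hb
    simp only [substWith]
    rw [Tm.subst_congr hb fun x hx => hf x (Or.inl hx), Tm.subst_congr hb fun x hx => hf x (Or.inr hx)]
  | rel P ts =>
    intro n σ τ hf hb
    simp only [substWith]
    congr 1
    funext i
    exact Tm.subst_congr hb fun x hx => hf x ⟨i, hx⟩
  | defn Φ =>
    intro n σ τ hf hb
    simp only [substWith]
    rw [hD σ τ Φ hf hb]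
  | neg φ ih =>
    intro n σ τ hf hb
    simp only [substWith]
    rw [ih σ τ hf hb]
  | and φ ψ ih₁ ih₂ | or φ ψ ih₁ ih₂ | imp φ ψ ih₁ ih₂ | iff φ ψ ih₁ ih₂ =>
    intro n σ τ hf hb
    simp only [substWith]
    rw [ih₁ σ τ (fun x hx => hf x (Or.inl hx)) hb, ih₂ σ τ (fun x hx => hf x (Or.inr hx)) hb]
  | all φ ih | ex φ ih =>
    intro n σ τ hf hb
    simp only [substWith]
    have := Sub.lift_congr 1 hf hb
    rw [ih _ _ this.1 this.2]

theorem substWith_one (sD : ∀ {m n : ℕ}, Sub L X m n → D m → D n)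
    (hD : ∀ {n : ℕ} (Φ : D n), sD (Sub.one L X n) Φ = Φ) {m : ℕ} (φ : Fml L X D m) :
    φ.substWith sD (Sub.one L X m) = φ := by
  induction φ with
  | _ => simp_all [substWith, Tm.subst_one, Sub.lift_one]

theorem finite_freeWith (fD : ∀ {n : ℕ}, D n → Set X) (hD : ∀ {n : ℕ} (Φ : D n), (fD Φ).Finite)
    {m : ℕ} (φ : Fml L X D m) : (φ.freeWith fD).Finite := by
  induction φ with
  | rel P ts =>
    have : (rel P ts : Fml L X D _).freeWith fD = ⋃ i, (ts i).free := by ext x; simp [freeWith]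
    rw [this]
    exact Set.finite_iUnion fun i => (ts i).finite_free
  | _ => simp_all [freeWith, Tm.finite_free]

end Fml

namespace FO

variable {m n : ℕ}

theorem subst_congr {σ τ : Sub L X m n} (φ : FO L X m) (hf : ∀ x ∈ φ.free, σ (.inl x) = τ (.inl x))
    (hb : ∀ i, σ (.inr i) = τ (.inr i)) : φ.subst σ = φ.subst τ :=
  Fml.substWith_congr (D := fun _ => Empty) (fun _ e => e.elim) (fun {_} e => e.elim)
    (fun _ _ Φ => Φ.elim) φ σ τ hf hb

theorem subst_one (φ : FO L X n) : φ.subst (Sub.one L X n) = φ :=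
  Fml.substWith_one _ (fun Φ => Φ.elim) φ

theorem finite_free (φ : FO L X n) : φ.free.Finite :=
  Fml.finite_freeWith _ (fun Φ => Φ.elim) φ

end FO

open Classical in
theorem Defn.subst_congr {m n : ℕ} {σ τ : Sub L X m n} (Φ : Defn L X m)
    (hf : ∀ x ∈ Φ.free, σ (.inl x) = τ (.inl x)) (hb : ∀ i, σ (.inr i) = τ (.inr i)) :
    Φ.subst σ = Φ.subst τ := by
  unfold Defn.subst
  apply Finset.image_congr
  intro r hr
  have := Sub.lift_congr r.numVars hf hb
  simp only [DefRule.subst, DefRule.mk.injEq, heq_eq_eq, true_and]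
  constructor
  · funext i
    exact Tm.subst_congr this.2 fun x hx => this.1 x ⟨r, hr, .inl ⟨i, hx⟩⟩
  · exact FO.subst_congr _ (fun x hx => this.1 x ⟨r, hr, .inr hx⟩) this.2

open Classical in
theorem Defn.subst_one {n : ℕ} (Φ : Defn L X n) : Φ.subst (Sub.one L X n) = Φ := by
  unfold Defn.subst
  simp only [DefRule.subst, Sub.lift_one, FO.subst_one, Tm.subst_one]
  exact Finset.image_id

theorem Defn.finite_free {n : ℕ} (Φ : Defn L X n) : Φ.free.Finite := by
  have : Φ.free = ⋃ r ∈ Φ, ((⋃ i, (r.args i).free) ∪ r.body.free) := by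
    ext x; simp [Defn.free, DefRule.free]
  rw [this]
  exact Φ.finite_toSet.biUnion fun r _ =>
    (Set.finite_iUnion fun i => (r.args i).finite_free).union r.body.finite_free

theorem Formula.subst_eq_self {n : ℕ} {σ : Sub L X n n} (φ : Formula L X n)
    (hf : ∀ x ∈ φ.free, σ (.inl x) = obj x) (hb : ∀ i, σ (.inr i) = bd i) : φ.subst σ = φ :=
  (Fml.substWith_congr (D := Defn L X) (fun τ Φ => Φ.subst τ) (@Defn.free L X)
    (fun _ _ Φ => Φ.subst_congr) φ σ (Sub.one L X n) hf hb).trans (Fml.substWith_one _ Defn.subst_one φ)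

theorem Formula.finite_free {n : ℕ} (φ : Formula L X n) : φ.free.Finite :=
  Fml.finite_freeWith _ Defn.finite_free φ

theorem FO.subst_toFormula {m : ℕ} (φ : FO L X m) : ∀ {n : ℕ} (σ : Sub L X m n),
    (φ.subst σ).toFormula = φ.toFormula.subst σ := by
  induction φ with
  | defn e => exact e.elim
  | _ => intros; simp_all [FO.toFormula, Formula.subst, Fml.substWith]

theorem finite_freeSet {Γ : Set (Formula L X 0)} (h : Γ.Finite) : (freeSet Γ).Finite := by
  have : freeSet Γ = ⋃ φ ∈ Γ, φ.free := by ext x; simp [freeSet]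
  rw [this]
  exact h.biUnion fun φ _ => φ.finite_free

theorem substSet_eq_self {Γ : Set (Formula L X 0)} {σ : Sub L X 0 0}
    (h : ∀ x ∈ freeSet Γ, σ (.inl x) = obj x) : substSet Γ σ = Γ := by
  have : ∀ φ ∈ Γ, φ.subst σ = φ := fun φ hφ =>
    φ.subst_eq_self (fun x hx => h x ⟨φ, hφ, hx⟩) fun i => i.elim0
  unfold substSet
  rw [Set.image_congr this, Set.image_id']

/-! ## Forcing -/

section Regular

variable {P : Type*} [Preorder P]

/-- `A` is dense below `p`. -/
def DenseBelow (A : P → Prop) (p : P) : Prop := ∀ q ≤ p, ∃ r ≤ q, A r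

/-- `A` is closed downwards and contains every `p` below which it is dense. -/
def IsRegular (A : P → Prop) : Prop := ∀ p, A p ↔ DenseBelow A p

theorem DenseBelow.mono {A : P → Prop} {p q : P} (h : DenseBelow A p) (hq : q ≤ p) :
    DenseBelow A q := fun r hr => h r (hr.trans hq)

theorem DenseBelow.imp {A B : P → Prop} {p : P} (h : DenseBelow A p)
    (hAB : ∀ q ≤ p, A q → B q) : DenseBelow B p := fun q hq =>
  let ⟨r, hr, ha⟩ := h q hq
  ⟨r, hr, hAB r (hr.trans hq) ha⟩

theorem denseBelow_of_downward {A : P → Prop} (hA : ∀ p q, q ≤ p → A p → A q) {p : P} (h : A p) :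
    DenseBelow A p := fun q hq => ⟨q, le_rfl, hA p q hq h⟩

theorem IsRegular.mono {A : P → Prop} (hA : IsRegular A) {p q : P} (h : A p) (hq : q ≤ p) : A q :=
  (hA q).2 (((hA p).1 h).mono hq)

theorem isRegular_of {A : P → Prop} (h₁ : ∀ p q, q ≤ p → A p → A q)
    (h₂ : ∀ p, DenseBelow A p → A p) : IsRegular A := fun p =>
  ⟨denseBelow_of_downward h₁, h₂ p⟩

/-- Two density steps compose into one. Disjunctions, existential formulas and the atoms of the
canonical model are regular for this reason. -/
theorem isRegular_denseBelow (A : P → Prop) : IsRegular (DenseBelow A) :=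
  isRegular_of (fun _ _ hq h => h.mono hq) fun _ h q hq =>
    let ⟨r, hr, h'⟩ := h q hq
    let ⟨s, hs, hA⟩ := h' r le_rfl
    ⟨s, hs.trans hr, hA⟩

theorem isRegular_true : IsRegular fun _ : P => True :=
  isRegular_of (fun _ _ _ _ => trivial) fun _ _ => trivial

theorem isRegular_false : IsRegular fun _ : P => False :=
  isRegular_of (fun _ _ _ h => h) fun p h => let ⟨_, _, h⟩ := h p le_rfl; h

theorem isRegular_not (A : P → Prop) (hA : IsRegular A) : IsRegular fun p => ∀ q ≤ p, ¬ A q :=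
  isRegular_of (fun _ _ hq h r hr => h r (hr.trans hq)) fun _ h q hq ha =>
    let ⟨r, hr, h'⟩ := h q hq
    h' r le_rfl (hA.mono ha hr)

theorem IsRegular.and {A B : P → Prop} (hA : IsRegular A) (hB : IsRegular B) :
    IsRegular fun p => A p ∧ B p :=
  isRegular_of (fun _ _ hq h => ⟨hA.mono h.1 hq, hB.mono h.2 hq⟩) fun p h =>
    ⟨(hA p).2 (h.imp fun _ _ => And.left), (hB p).2 (h.imp fun _ _ => And.right)⟩

theorem isRegular_forall {ι : Sort*} {A : ι → P → Prop} (hA : ∀ i, IsRegular (A i)) :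
    IsRegular fun p => ∀ i, A i p :=
  isRegular_of (fun _ _ hq h i => (hA i).mono (h i) hq) fun p h i =>
    (hA i p).2 (h.imp fun _ _ h => h i)

/-- The premise need only persist to stronger conditions; regularity of the conclusion suffices
because the premise survives to the conditions where the implication is known. -/
theorem IsRegular.imp {A B : P → Prop} (hA : ∀ p q, q ≤ p → A p → A q) (hB : IsRegular B) :
    IsRegular fun p => ∀ q ≤ p, A q → B q :=
  isRegular_of (fun _ _ hq h r hr => h r (hr.trans hq)) fun _ h q hq ha =>
    (hB q).2 fun q' hq' =>
      let ⟨r, hr, h'⟩ := h q' (hq'.trans hq)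
      ⟨r, hr, h' r le_rfl (hA _ _ (hr.trans hq') ha)⟩

end Regular

/-- A relation symbol is interpreted by a relation between closed terms at every condition. -/
abbrev RelInterp (L : FirstOrder.Language.{u, v}) (X : Type w) (P : Type*) :=
  P → (Q : Pred L) → (Fin Q.1 → Tm L X 0) → Prop

/-- The condition `p` forces a formula under the assignment `e`, where `Rp` interprets the positive
and `Rn` the negative occurrences of relation symbols. -/
def Fml.force {P : Type*} [Preorder P] {D : ℕ → Type d} (E : P → Tm L X 0 → Tm L X 0 → Prop)
    (fD : ∀ {n : ℕ}, D n → Sub L X n 0 → P → Prop) :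
    {n : ℕ} → Fml L X D n → RelInterp L X P → RelInterp L X P → Sub L X n 0 → P → Prop
  | _, top, _, _, _, _ => True
  | _, bot, _, _, _, _ => False
  | _, eq t s, _, _, e, p => E p (t.subst e) (s.subst e)
  | _, rel Q ts, Rp, _, e, p => Rp p Q fun i => (ts i).subst e
  | _, defn Φ, _, _, e, p => fD Φ e p
  | _, neg φ, Rp, Rn, e, p => ∀ q ≤ p, ¬ force E fD φ Rn Rp e q
  | _, and φ ψ, Rp, Rn, e, p => force E fD φ Rp Rn e p ∧ force E fD ψ Rp Rn e p
  | _, or φ ψ, Rp, Rn, e, p =>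
      DenseBelow (fun q => force E fD φ Rp Rn e q ∨ force E fD ψ Rp Rn e q) p
  | _, imp φ ψ, Rp, Rn, e, p => ∀ q ≤ p, force E fD φ Rn Rp e q → force E fD ψ Rp Rn e q
  | _, iff φ ψ, Rp, Rn, e, p =>
      (∀ q ≤ p, force E fD φ Rn Rp e q → force E fD ψ Rp Rn e q) ∧
        ∀ q ≤ p, force E fD ψ Rn Rp e q → force E fD φ Rp Rn e q
  | _, all φ, Rp, Rn, e, p => ∀ t, force E fD φ Rp Rn (e.ext fun _ => t) p
  | _, ex φ, Rp, Rn, e, p => DenseBelow (fun q => ∃ t, force E fD φ Rp Rn (e.ext fun _ => t) q) p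

/-- A Boolean-valued term model over the conditions `P`. -/
structure ForcingModel (L : FirstOrder.Language.{u, v}) (X : Type w) (P : Type*) [Preorder P] where
  eq : P → Tm L X 0 → Tm L X 0 → Prop
  rel : RelInterp L X P
  eq_regular : ∀ t s, IsRegular fun p => eq p t s
  eq_refl : ∀ p t, eq p t t
  eq_symm : ∀ p t s, eq p t s → eq p s t
  eq_trans : ∀ p t s r, eq p t s → eq p s r → eq p t r
  eq_func : ∀ p k (f : L.Functions k) ts ss, (∀ i, eq p (ts i) (ss i)) → eq p (.func f ts) (.func f ss)
  rel_regular : ∀ Q ts, IsRegular fun p => rel p Q ts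
  rel_congr : ∀ p Q ts ss, (∀ i, eq p (ts i) (ss i)) → rel p Q ts → rel p Q ss

/-! ### The forcing relation: regularity, substitution, congruence and definitions. -/

namespace ForcingModel

variable {P : Type*} [Preorder P] (M : ForcingModel L X P)

/-- The relation symbols are interpreted by regular relations that respect equality. -/
structure Admissible (R : RelInterp L X P) : Prop where
  regular : ∀ Q ts, IsRegular fun p => R p Q ts
  congr : ∀ p Q ts ss, (∀ i, M.eq p (ts i) (ss i)) → R p Q ts → R p Q ss

theorem admissible_rel : M.Admissible M.rel := ⟨M.rel_regular, M.rel_congr⟩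

variable {M}

theorem subst_eq_subst {n : ℕ} {e e' : Sub L X n 0} {p : P}
    (hb : ∀ i, M.eq p (e (.inr i)) (e' (.inr i))) : ∀ {t : Tm L X n},
      (∀ x ∈ t.free, M.eq p (e (.inl x)) (e' (.inl x))) → M.eq p (t.subst e) (t.subst e')
  | .var (.inl x), h => h x (by simp [Tm.free])
  | .var (.inr i), _ => hb i
  | .func f ts, h => M.eq_func _ _ _ _ _ fun i =>
      subst_eq_subst hb fun x hx => h x (by simp only [Tm.free]; exact ⟨i, hx⟩)

section Generic

variable {D : ℕ → Type d} {fD : ∀ {n : ℕ}, D n → Sub L X n 0 → P → Prop}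

theorem force_regular (hD : ∀ {n : ℕ} (Φ : D n) e, IsRegular (fD Φ e)) {n : ℕ} (φ : Fml L X D n) :
    ∀ {Rp Rn : RelInterp L X P}, M.Admissible Rp → M.Admissible Rn → ∀ e,
      IsRegular (φ.force M.eq fD Rp Rn e) := by
  induction φ with
  | top => intros; exact isRegular_true
  | bot => intros; exact isRegular_false
  | eq t s => intros; exact M.eq_regular _ _
  | rel Q ts => intro Rp Rn hp hn e; exact hp.regular _ _
  | defn Φ => intros; exact hD _ _
  | neg φ ih => intro Rp Rn hp hn e; exact isRegular_not _ (ih hn hp e)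
  | and φ ψ ih₁ ih₂ => intro Rp Rn hp hn e; exact (ih₁ hp hn e).and (ih₂ hp hn e)
  | or φ ψ ih₁ ih₂ => intros; exact isRegular_denseBelow _
  | imp φ ψ ih₁ ih₂ =>
    intro Rp Rn hp hn e
    exact (ih₂ hp hn e).imp fun _ _ hq h => (ih₁ hn hp e).mono h hq
  | iff φ ψ ih₁ ih₂ =>
    intro Rp Rn hp hn e
    exact ((ih₂ hp hn e).imp fun _ _ hq h => (ih₁ hn hp e).mono h hq).and
      ((ih₁ hp hn e).imp fun _ _ hq h => (ih₂ hn hp e).mono h hq)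
  | all φ ih => intro Rp Rn hp hn e; exact isRegular_forall fun t => ih hp hn _
  | ex φ ih => intros; exact isRegular_denseBelow _

theorem force_substWith (sD : ∀ {m n : ℕ}, Sub L X m n → D m → D n)
    (hD : ∀ {m n : ℕ} (σ : Sub L X m n) (Φ : D m) e p, fD (sD σ Φ) e p ↔ fD Φ (σ.comp e) p)
    {m : ℕ} (φ : Fml L X D m) : ∀ {n : ℕ} (σ : Sub L X m n) (Rp Rn : RelInterp L X P) (e) (p : P),
      (φ.substWith sD σ).force M.eq fD Rp Rn e p ↔ φ.force M.eq fD Rp Rn (σ.comp e) p := by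
  induction φ with
  | top => intros; rfl
  | bot => intros; rfl
  | eq t s => intros; simp only [Fml.force, Fml.substWith, Tm.subst_subst]
  | rel Q ts => intros; simp only [Fml.force, Fml.substWith, Tm.subst_subst]
  | defn Φ => intro n σ Rp Rn e p; exact hD σ Φ e p
  | neg φ ih => intros; simp only [Fml.force, Fml.substWith, ih]
  | and φ ψ ih₁ ih₂ | or φ ψ ih₁ ih₂ | imp φ ψ ih₁ ih₂ | iff φ ψ ih₁ ih₂ =>
    intros; simp only [Fml.force, Fml.substWith, ih₁, ih₂]
  | all φ ih | ex φ ih =>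
    intros; simp only [Fml.force, Fml.substWith, ih, Sub.lift_comp_ext]

theorem denseBelow_congr {A B : P → Prop} {p : P} (h : ∀ q ≤ p, (A q ↔ B q)) :
    DenseBelow A p ↔ DenseBelow B p :=
  ⟨fun hA => hA.imp fun q hq => (h q hq).1, fun hB => hB.imp fun q hq => (h q hq).2⟩

/-- The assignments `e` and `e'` agree on `s` and on the bound object symbols. -/
def Agree (M : ForcingModel L X P) {n : ℕ} (s : Set X) (e e' : Sub L X n 0) (p : P) : Prop :=
  (∀ x ∈ s, M.eq p (e (.inl x)) (e' (.inl x))) ∧ ∀ i, M.eq p (e (.inr i)) (e' (.inr i))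

theorem Agree.mono {n : ℕ} {s s' : Set X} {e e' : Sub L X n 0} {p q : P} (h : M.Agree s e e' p)
    (hs : s' ⊆ s) (hq : q ≤ p) : M.Agree s' e e' q :=
  ⟨fun x hx => (M.eq_regular _ _).mono (h.1 x (hs hx)) hq,
    fun i => (M.eq_regular _ _).mono (h.2 i) hq⟩

theorem Agree.symm {n : ℕ} {s : Set X} {e e' : Sub L X n 0} {p : P} (h : M.Agree s e e' p) :
    M.Agree s e' e p :=
  ⟨fun x hx => M.eq_symm _ _ _ (h.1 x hx), fun i => M.eq_symm _ _ _ (h.2 i)⟩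

theorem Agree.ext {n k : ℕ} {s : Set X} {e e' : Sub L X n 0} {p : P} (h : M.Agree s e e' p)
    (a : Fin k → Tm L X 0) : M.Agree s (e.ext a) (e'.ext a) p := by
  refine ⟨h.1, fun i => ?_⟩
  induction i using Fin.addCases with
  | left i => simpa [Sub.ext] using h.2 i
  | right i => simpa [Sub.ext] using M.eq_refl _ _

theorem Agree.tm {n : ℕ} {s : Set X} {e e' : Sub L X n 0} {p : P} (h : M.Agree s e e' p)
    {t : Tm L X n} (ht : t.free ⊆ s) : M.eq p (t.subst e) (t.subst e') :=
  subst_eq_subst h.2 fun x hx => h.1 x (ht hx)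

/-- Forced equality persists to stronger conditions, so agreement of assignments passes through the
clauses that range over all `q ≤ p`. Agreement only on the free symbols makes this usable for
eigenvariables, and agreement only up to forced equality makes it usable for (=L). -/
theorem force_congr (sf : ∀ {n : ℕ}, D n → Set X)
    (hD : ∀ {n : ℕ} (Φ : D n) e e' p, M.Agree (sf Φ) e e' p → (fD Φ e p ↔ fD Φ e' p))
    {n : ℕ} (φ : Fml L X D n) : ∀ {Rp Rn : RelInterp L X P}, M.Admissible Rp → M.Admissible Rn →
      ∀ e e' p, M.Agree (φ.freeWith sf) e e' p →
        (φ.force M.eq fD Rp Rn e p ↔ φ.force M.eq fD Rp Rn e' p) := by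
  induction φ with
  | top => intros; rfl
  | bot => intros; rfl
  | eq t s =>
    intro Rp Rn hp hn e e' p h
    have h₁ := h.tm (t := t) Set.subset_union_left
    have h₂ := h.tm (t := s) Set.subset_union_right
    exact ⟨fun H => M.eq_trans _ _ _ _ (M.eq_symm _ _ _ h₁) (M.eq_trans _ _ _ _ H h₂),
      fun H => M.eq_trans _ _ _ _ h₁ (M.eq_trans _ _ _ _ H (M.eq_symm _ _ _ h₂))⟩
  | rel Q ts =>
    intro Rp Rn hp hn e e' p h
    have h₁ : ∀ i, M.eq p ((ts i).subst e) ((ts i).subst e') := fun i => h.tm fun x hx => ⟨i, hx⟩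
    exact ⟨hp.congr _ _ _ _ h₁, hp.congr _ _ _ _ fun i => M.eq_symm _ _ _ (h₁ i)⟩
  | defn Φ => intro Rp Rn hp hn e e' p h; exact hD _ _ _ _ h
  | neg φ ih =>
    intro Rp Rn hp hn e e' p h
    exact forall₂_congr fun q hq => not_congr (ih hn hp _ _ _ (h.mono subset_rfl hq))
  | and φ ψ ih₁ ih₂ =>
    intro Rp Rn hp hn e e' p h
    exact and_congr (ih₁ hp hn _ _ _ (h.mono Set.subset_union_left le_rfl))
      (ih₂ hp hn _ _ _ (h.mono Set.subset_union_right le_rfl))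
  | or φ ψ ih₁ ih₂ =>
    intro Rp Rn hp hn e e' p h
    exact denseBelow_congr fun q hq =>
      or_congr (ih₁ hp hn _ _ _ (h.mono Set.subset_union_left hq))
        (ih₂ hp hn _ _ _ (h.mono Set.subset_union_right hq))
  | imp φ ψ ih₁ ih₂ =>
    intro Rp Rn hp hn e e' p h
    exact forall₂_congr fun q hq =>
      imp_congr (ih₁ hn hp _ _ _ (h.mono Set.subset_union_left hq))
        (ih₂ hp hn _ _ _ (h.mono Set.subset_union_right hq))
  | iff φ ψ ih₁ ih₂ =>
    intro Rp Rn hp hn e e' p h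
    exact and_congr
      (forall₂_congr fun q hq =>
        imp_congr (ih₁ hn hp _ _ _ (h.mono Set.subset_union_left hq))
          (ih₂ hp hn _ _ _ (h.mono Set.subset_union_right hq)))
      (forall₂_congr fun q hq =>
        imp_congr (ih₂ hn hp _ _ _ (h.mono Set.subset_union_right hq))
          (ih₁ hp hn _ _ _ (h.mono Set.subset_union_left hq)))
  | all φ ih =>
    intro Rp Rn hp hn e e' p h
    exact forall_congr' fun t => ih hp hn _ _ _ (h.ext _)
  | ex φ ih =>
    intro Rp Rn hp hn e e' p h
    exact denseBelow_congr fun q hq =>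
      exists_congr fun t => ih hp hn _ _ _ ((h.mono subset_rfl hq).ext _)

end Generic

variable (M) in
/-- Forcing of first-order formulas. -/
def forceFO (Rp Rn : RelInterp L X P) {n : ℕ} (φ : FO L X n) (e : Sub L X n 0) (p : P) : Prop :=
  φ.force M.eq (fun {_} (x : Empty) _ _ => x.elim) Rp Rn e p

theorem forceFO_regular {Rp Rn : RelInterp L X P} (hp : M.Admissible Rp) (hn : M.Admissible Rn)
    {n : ℕ} (φ : FO L X n) (e : Sub L X n 0) : IsRegular (M.forceFO Rp Rn φ e) :=
  force_regular (D := fun _ => Empty) (fun {_} x => x.elim) φ hp hn e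

theorem forceFO_subst {m n : ℕ} (φ : FO L X m) (σ : Sub L X m n) (Rp Rn : RelInterp L X P) (e) (p : P) :
    M.forceFO Rp Rn (φ.subst σ) e p ↔ M.forceFO Rp Rn φ (σ.comp e) p :=
  force_substWith (D := fun _ => Empty) _ (fun _ x => x.elim) φ σ Rp Rn e p

theorem forceFO_congr {Rp Rn : RelInterp L X P} (hp : M.Admissible Rp) (hn : M.Admissible Rn)
    {n : ℕ} (φ : FO L X n) {e e' : Sub L X n 0} {p : P} (h : M.Agree φ.free e e' p) :
    M.forceFO Rp Rn φ e p ↔ M.forceFO Rp Rn φ e' p :=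
  force_congr (D := fun _ => Empty) (fun {_} x => x.elim) (fun {_} x => x.elim) φ hp hn e e' p h

open Classical in
variable (M) in
/-- The predicates in `S` are reinterpreted by the formulas `F`, under the assignment `c`. -/
def update (S : Set (Pred L)) (F : (Q : Pred L) → FO L X Q.1) (c : X → Tm L X 0) : RelInterp L X P :=
  fun p Q ts => if Q ∈ S then M.forceFO M.rel M.rel (F Q) (Sum.elim c ts) p else M.rel p Q ts

theorem admissible_update (S : Set (Pred L)) (F : (Q : Pred L) → FO L X Q.1) (c : X → Tm L X 0) :
    M.Admissible (M.update S F c) := by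
  constructor
  · intro Q ts
    by_cases hQ : Q ∈ S
    · simpa [update, hQ] using forceFO_regular M.admissible_rel M.admissible_rel _ _
    · simpa [update, hQ] using M.rel_regular Q ts
  · intro p Q ts ss h
    by_cases hQ : Q ∈ S
    · simp only [update, hQ, if_true]
      exact (forceFO_congr M.admissible_rel M.admissible_rel (F Q) (e := Sum.elim c ts)
        (e' := Sum.elim c ss) ⟨fun x _ => M.eq_refl _ _, h⟩).1
    · simpa [update, hQ] using M.rel_congr p Q ts ss h

/-- The polarity flag of `replace` flips exactly where forcing exchanges its two interpretations. At
a replaced atom the substituted formula is evaluated in the current assignment; the hypothesis on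
`e` and `c` says that this assignment still gives the parameters of `F` their values, also under
binders. -/
theorem forceFO_replace {S : Set (Pred L)} {F : (Q : Pred L) → FO L X Q.1} {c : X → Tm L X 0}
    {n : ℕ} (φ : FO L X n) : ∀ (b : Bool) (e : Sub L X n 0) (p : P),
      (∀ Q ∈ S, ∀ x ∈ (F Q).free, e (.inl x) = c x) →
      (M.forceFO M.rel M.rel (φ.replace S F b) e p ↔
        M.forceFO (cond b (M.update S F c) M.rel) (cond b M.rel (M.update S F c)) φ e p) := by
  induction φ with
  | top => intros; rfl
  | bot => intros; rfl
  | eq t s => intros; rfl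
  | defn x => exact x.elim
  | rel Q ts =>
    intro b e p h
    rcases b with _ | _
    · rfl
    · by_cases hQ : Q ∈ S
      · simp only [FO.replace, hQ, and_self, if_true, forceFO_subst, Sub.args_comp]
        simp only [cond, forceFO, Fml.force, update, hQ, if_true]
        exact forceFO_congr M.admissible_rel M.admissible_rel _
          ⟨fun x hx => by simp [h Q hQ x hx, M.eq_refl], fun i => M.eq_refl _ _⟩
      · simp [FO.replace, hQ, forceFO, Fml.force, update]
  | neg φ ih =>
    intro b e p h
    have := fun q => ih (!b) e q h
    simp only [Bool.cond_not] at this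
    exact forall₂_congr fun q _ => not_congr (this q)
  | and φ ψ ih₁ ih₂ =>
    intro b e p h
    exact and_congr (ih₁ b e p h) (ih₂ b e p h)
  | or φ ψ ih₁ ih₂ =>
    intro b e p h
    exact denseBelow_congr fun q _ => or_congr (ih₁ b e q h) (ih₂ b e q h)
  | imp φ ψ ih₁ ih₂ =>
    intro b e p h
    have := fun q => ih₁ (!b) e q h
    simp only [Bool.cond_not] at this
    exact forall₂_congr fun q _ => imp_congr (this q) (ih₂ b e q h)
  | iff φ ψ ih₁ ih₂ =>
    intro b e p h
    have h₁ := fun q => ih₁ (!b) e q h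
    have h₂ := fun q => ih₂ (!b) e q h
    simp only [Bool.cond_not] at h₁ h₂
    exact and_congr (forall₂_congr fun q _ => imp_congr (h₁ q) (ih₂ b e q h))
      (forall₂_congr fun q _ => imp_congr (h₂ q) (ih₁ b e q h))
  | all φ ih =>
    intro b e p h
    exact forall_congr' fun t => ih b _ p h
  | ex φ ih =>
    intro b e p h
    exact denseBelow_congr fun q _ => exists_congr fun t => ih b _ q h

variable (M) in
/-- All instances of the rule `r` hold below `p`, with the positive occurrences in the body
interpreted by `U`, those in the head by `V`. -/
def RuleClosed {n : ℕ} (r : DefRule L X n) (U V : RelInterp L X P) (e : Sub L X n 0) (p : P) : Prop :=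
  ∀ q ≤ p, ∀ a, M.forceFO U M.rel r.body (e.ext a) q → V q r.head fun j => (r.args j).subst (e.ext a)

variable (M) in
/-- The condition `p` forces a definition if its defined predicates are closed under its rules and
contained in every family of definable relations that is closed under the rules. -/
def forceDefn {n : ℕ} (Φ : Defn L X n) (e : Sub L X n 0) (p : P) : Prop :=
  (∀ r ∈ Φ, M.RuleClosed r M.rel M.rel e p) ∧
    ∀ S ⊆ Φ.defined, ∀ F c, ∀ Q ∈ S, ∀ ts, ∀ q ≤ p,
      (∀ r ∈ Φ, r.head ∈ S → M.RuleClosed r (M.update S F c) (M.update S F c) e q) ∧ M.rel q Q ts →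
        M.update S F c q Q ts

theorem RuleClosed.mono {n : ℕ} {r : DefRule L X n} {U V : RelInterp L X P} {e : Sub L X n 0} {p q : P}
    (h : M.RuleClosed r U V e p) (hq : q ≤ p) : M.RuleClosed r U V e q :=
  fun q' hq' => h q' (hq'.trans hq)

theorem RuleClosed.regular {n : ℕ} {r : DefRule L X n} {U V : RelInterp L X P} (hU : M.Admissible U)
    (hV : M.Admissible V) {e : Sub L X n 0} : IsRegular (M.RuleClosed r U V e) := by
  have : M.RuleClosed r U V e = fun p => ∀ a, ∀ q ≤ p, M.forceFO U M.rel r.body (e.ext a) q →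
      V q r.head fun j => (r.args j).subst (e.ext a) :=
    funext fun p => propext ⟨fun h a q hq => h q hq a, fun h q hq a => h a q hq⟩
  rw [this]
  exact isRegular_forall fun a => (hV.regular _ _).imp fun _ _ hq h =>
    (forceFO_regular hU M.admissible_rel _ _).mono h hq

theorem forceDefn_regular {n : ℕ} (Φ : Defn L X n) (e : Sub L X n 0) :
    IsRegular (M.forceDefn Φ e) := by
  refine IsRegular.and ?_ ?_
  · exact isRegular_forall fun r => isRegular_forall fun _ =>
      RuleClosed.regular M.admissible_rel M.admissible_rel
  · refine isRegular_forall fun S => isRegular_forall fun _ => isRegular_forall fun F =>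
      isRegular_forall fun c => isRegular_forall fun Q => isRegular_forall fun _ =>
      isRegular_forall fun ts => IsRegular.imp ?_ ((admissible_update S F c).regular Q ts)
    exact fun p q hq h => ⟨fun r hr hS => (h.1 r hr hS).mono hq, (M.rel_regular Q ts).mono h.2 hq⟩

theorem RuleClosed.congr {n : ℕ} {r : DefRule L X n} {U V : RelInterp L X P} (hU : M.Admissible U)
    (hV : M.Admissible V) {e e' : Sub L X n 0} {p : P} (hr : M.Agree r.free e e' p)
    (h : M.RuleClosed r U V e p) : M.RuleClosed r U V e' p := by
  intro q hq a hbody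
  refine hV.congr _ _ _ _ (fun j => ?_) (h q hq a
    ((forceFO_congr hU M.admissible_rel _ (((hr.mono ?_ hq).ext a))).2 hbody))
  · exact ((hr.mono subset_rfl hq).ext a).tm fun x hx => .inl ⟨j, hx⟩
  · exact Set.subset_union_right

theorem forceDefn_congr {n : ℕ} (Φ : Defn L X n) {e e' : Sub L X n 0} {p : P}
    (h : M.Agree Φ.free e e' p) : M.forceDefn Φ e p ↔ M.forceDefn Φ e' p := by
  have key : ∀ {e e' : Sub L X n 0}, M.Agree Φ.free e e' p → M.forceDefn Φ e p →
      M.forceDefn Φ e' p := by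
    intro e e' h H
    have hr : ∀ r ∈ Φ, r.free ⊆ Φ.free := fun r hr x hx => ⟨r, hr, hx⟩
    refine ⟨fun r hrm => RuleClosed.congr M.admissible_rel M.admissible_rel
      (h.mono (hr r hrm) le_rfl) (H.1 r hrm), fun S hS F c Q hQ ts q hq hcl =>
      H.2 S hS F c Q hQ ts q hq ⟨?_, hcl.2⟩⟩
    -- Closure under the rules is a premise of the induction clause, so here the agreement is used
    -- in the opposite direction.
    exact fun r hrm hrS => RuleClosed.congr (admissible_update S F c) (admissible_update S F c)
      (h.mono (hr r hrm) hq).symm (hcl.1 r hrm hrS)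
  exact ⟨key h, key h.symm⟩

theorem ruleClosed_subst {m n : ℕ} (r : DefRule L X m) (σ : Sub L X m n) (U V : RelInterp L X P)
    (e : Sub L X n 0) (p : P) : M.RuleClosed (r.subst σ) U V e p ↔ M.RuleClosed r U V (σ.comp e) p := by
  simp only [RuleClosed, DefRule.subst, forceFO_subst, Sub.lift_comp_ext, Tm.subst_subst]

theorem _root_.FOID.Defn.defined_subst {m n : ℕ} (Φ : Defn L X m) (σ : Sub L X m n) :
    (Φ.subst σ).defined = Φ.defined := by
  ext Q
  simp [Defn.defined, Defn.subst, DefRule.subst]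

theorem forceDefn_subst {m n : ℕ} (σ : Sub L X m n) (Φ : Defn L X m) (e : Sub L X n 0) (p : P) :
    M.forceDefn (Φ.subst σ) e p ↔ M.forceDefn Φ (σ.comp e) p := by
  have h : ∀ A : DefRule L X n → Prop, (∀ r ∈ Φ.subst σ, A r) ↔ ∀ r ∈ Φ, A (r.subst σ) := by
    intro A
    simp [Defn.subst]
  simp only [forceDefn, Defn.defined_subst, h, ruleClosed_subst]
  rfl

variable (M) in
/-- Forcing of FO(ID)-formulas. -/
def force {n : ℕ} (φ : Formula L X n) (e : Sub L X n 0) (p : P) : Prop :=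
  φ.force M.eq (fun {_} Φ => M.forceDefn Φ) M.rel M.rel e p

theorem force_isRegular {n : ℕ} (φ : Formula L X n) (e : Sub L X n 0) : IsRegular (M.force φ e) :=
  force_regular (D := Defn L X) forceDefn_regular φ M.admissible_rel M.admissible_rel e

theorem force_subst {m n : ℕ} (φ : Formula L X m) (σ : Sub L X m n) (e) (p : P) :
    M.force (φ.subst σ) e p ↔ M.force φ (σ.comp e) p :=
  force_substWith (D := Defn L X) _ forceDefn_subst φ σ _ _ e p

theorem force_congr_free {n : ℕ} (φ : Formula L X n) {e e' : Sub L X n 0} {p : P}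
    (h : M.Agree φ.free e e' p) : M.force φ e p ↔ M.force φ e' p :=
  force_congr (D := Defn L X) (@Defn.free L X) (fun Φ _ _ _ => forceDefn_congr Φ) φ
    M.admissible_rel M.admissible_rel e e' p h

theorem force_toFormula {n : ℕ} (φ : FO L X n) : ∀ (e) (p : P),
    M.force φ.toFormula e p ↔ M.forceFO M.rel M.rel φ e p := by
  induction φ with
  | defn x => exact x.elim
  | _ => intros; simp_all [FO.toFormula, force, forceFO, Fml.force]

end ForcingModel

/-! ## Soundness -/

namespace ForcingModel

variable {P : Type*} [Preorder P] {M : ForcingModel L X P}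

variable (M) in
/-- The condition `p` forces all formulas in `Γ`. -/
def Forces (Γ : Set (Formula L X 0)) (e : Sub L X 0 0) (p : P) : Prop := ∀ φ ∈ Γ, M.force φ e p

variable (M) in
/-- The condition `p` forces the negations of all formulas in `Δ`. -/
def Refutes (Δ : Set (Formula L X 0)) (e : Sub L X 0 0) (p : P) : Prop :=
  ∀ φ ∈ Δ, ∀ q ≤ p, ¬ M.force φ e q

variable {Γ Δ : Set (Formula L X 0)} {φ : Formula L X 0} {e e' : Sub L X 0 0} {p q : P}

theorem forces_insert : M.Forces (insert φ Γ) e p ↔ M.force φ e p ∧ M.Forces Γ e p := by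
  simp [Forces]

theorem refutes_insert :
    M.Refutes (insert φ Δ) e p ↔ (∀ q ≤ p, ¬ M.force φ e q) ∧ M.Refutes Δ e p := by
  simp [Refutes]

theorem force_mono {n : ℕ} {φ : Formula L X n} {e : Sub L X n 0}
    (h : M.force φ e p) (hq : q ≤ p) : M.force φ e q := (force_isRegular φ e).mono h hq

theorem Forces.mono (h : M.Forces Γ e p) (hq : q ≤ p) : M.Forces Γ e q := fun φ hφ =>
  force_mono (h φ hφ) hq

theorem Refutes.mono (h : M.Refutes Δ e p) (hq : q ≤ p) : M.Refutes Δ e q := fun φ hφ r hr =>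
  h φ hφ r (hr.trans hq)

/-- By regularity, a formula that is not forced is refuted by some stronger condition. This is how a
premise with an additional formula on the right yields that this formula is forced, and it makes cut
sound. -/
theorem force_of_not_refutes (h : M.Refutes Δ e p) (hi : ∀ q ≤ p, ¬ M.Refutes (insert φ Δ) e q) :
    M.force φ e p := by
  refine (force_isRegular φ e p).2 fun q hq => ?_
  by_contra! hr
  exact hi q hq (refutes_insert.2 ⟨hr, h.mono hq⟩)

theorem forces_substSet {σ : Sub L X 0 0} :
    M.Forces (substSet Γ σ) e p ↔ M.Forces Γ (σ.comp e) p := by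
  simp [Forces, substSet, force_subst]

theorem refutes_substSet {σ : Sub L X 0 0} :
    M.Refutes (substSet Γ σ) e p ↔ M.Refutes Γ (σ.comp e) p := by
  simp [Refutes, substSet, force_subst]

theorem Agree.free {ψ : Formula L X 0} (h : M.Agree (freeSet Γ) e e' p) (hψ : ψ ∈ Γ) :
    M.Agree ψ.free e e' p := h.mono (fun _ hx => ⟨ψ, hψ, hx⟩) le_rfl

theorem Forces.congr (h : M.Agree (freeSet Γ) e e' p) (H : M.Forces Γ e p) : M.Forces Γ e' p :=
  fun φ hφ => (force_congr_free φ (h.free hφ)).1 (H φ hφ)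

theorem Refutes.congr (h : M.Agree (freeSet Γ) e e' p) (H : M.Refutes Γ e p) : M.Refutes Γ e' p :=
  fun φ hφ q hq hf => H φ hφ q hq ((force_congr_free φ ((h.mono subset_rfl hq).free hφ)).2 hf)

/-- The assignment `e` with the values of the symbols `y i` changed to `a i`. -/
noncomputable def assign {k : ℕ} (e : Sub L X 0 0) (y : Fin k → X) (a : Fin k → Tm L X 0) : Sub L X 0 0 :=
  Sum.elim (Function.extend y a fun x => e (.inl x)) fun i => e (.inr i)

theorem assign_of_fresh {k : ℕ} {y : Fin k → X} {a : Fin k → Tm L X 0} {x : X}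
    (h : ∀ i, y i ≠ x) : assign e y a (.inl x) = e (.inl x) := by
  simp only [assign, Sum.elim_inl]
  exact Function.extend_apply' _ _ _ fun ⟨i, hi⟩ => h i hi

theorem agree_assign {k : ℕ} {y : Fin k → X} {a : Fin k → Tm L X 0} {s : Set X}
    (h : ∀ i, y i ∉ s) (p : P) : M.Agree s e (assign e y a) p := by
  refine ⟨fun x hx => ?_, fun i => i.elim0⟩
  have hy : ∀ i, y i ≠ x := fun i hi => h i (hi ▸ hx)
  rw [assign_of_fresh hy]
  exact M.eq_refl _ _

/-- Instantiating bound symbols by named ones and then assigning values to the names amounts to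
extending the assignment by these values. Injectivity ensures that the names receive their values
without conflict. -/
theorem inst_comp_assign {k : ℕ} {y : Fin k → X} (hy : Function.Injective y) (a : Fin k → Tm L X 0) :
    (Sub.inst fun i => obj (y i)).comp (assign e y a) = (assign e y a).ext a := by
  rw [Sub.inst_comp]
  congr 1
  funext i
  simp [obj, FirstOrder.Language.Term.subst, assign, hy.extend_apply]

variable (M) in
/-- No condition forces the left side and refutes the right side of the sequent. -/
def Valid (Γ Δ : Set (Formula L X 0)) : Prop :=
  ∀ (e : Sub L X 0 0) (p : P), M.Forces Γ e p → ¬ M.Refutes Δ e p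

/-- The premise is evaluated at the assignment that sends `x` to an arbitrary `t`. As `x` is fresh,
neither the side formulas nor the quantified formula notice the change. -/
theorem valid_allR {φ : Formula L X (0 + 1)} {x : X} (hx : x ∉ freeSet (Γ ∪ Δ))
    (hφ : x ∉ Formula.free φ.all) (h : M.Valid Γ (insert (φ.subst (Sub.inst fun _ => obj x)) Δ)) :
    M.Valid Γ (insert φ.all Δ) := by
  intro e p hΓ hΔ
  rw [refutes_insert] at hΔ
  refine hΔ.1 p le_rfl fun t => ?_
  have hy : Function.Injective fun _ : Fin 1 => x := fun _ _ _ => Subsingleton.elim _ _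
  have hag := fun (q : P) => agree_assign (M := M) (e := e) (y := fun _ : Fin 1 => x) (a := fun _ => t)
    (s := freeSet (Γ ∪ Δ)) (fun _ => hx) q
  have hs₁ : freeSet Γ ⊆ freeSet (Γ ∪ Δ) := fun z ⟨ψ, h, hz⟩ => ⟨ψ, .inl h, hz⟩
  have hs₂ : freeSet Δ ⊆ freeSet (Γ ∪ Δ) := fun z ⟨ψ, h, hz⟩ => ⟨ψ, .inr h, hz⟩
  have key := force_of_not_refutes
    (hΔ.2.congr ((hag p).mono hs₂ le_rfl)) fun q hq => h _ q ((hΓ.congr ((hag p).mono hs₁ le_rfl)).mono hq)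
  rw [force_subst, inst_comp_assign hy] at key
  exact (force_congr_free φ ((agree_assign (fun _ => hφ) p).ext _)).2 key

theorem valid_exL {φ : Formula L X (0 + 1)} {x : X} (hx : x ∉ freeSet (Γ ∪ Δ))
    (hφ : x ∉ Formula.free φ.ex) (h : M.Valid (insert (φ.subst (Sub.inst fun _ => obj x)) Γ) Δ) :
    M.Valid (insert φ.ex Γ) Δ := by
  intro e p hΓ hΔ
  rw [forces_insert] at hΓ
  obtain ⟨q, hq, t, ht⟩ := hΓ.1 p le_rfl
  have hy : Function.Injective fun _ : Fin 1 => x := fun _ _ _ => Subsingleton.elim _ _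
  have hag := agree_assign (M := M) (e := e) (y := fun _ : Fin 1 => x) (a := fun _ => t)
    (s := freeSet (Γ ∪ Δ)) (fun _ => hx) q
  have hs₁ : freeSet Γ ⊆ freeSet (Γ ∪ Δ) := fun z ⟨ψ, h, hz⟩ => ⟨ψ, .inl h, hz⟩
  have hs₂ : freeSet Δ ⊆ freeSet (Γ ∪ Δ) := fun z ⟨ψ, h, hz⟩ => ⟨ψ, .inr h, hz⟩
  refine h _ q (forces_insert.2 ⟨?_, (hΓ.2.mono hq).congr (hag.mono hs₁ le_rfl)⟩)
    ((hΔ.mono hq).congr (hag.mono hs₂ le_rfl))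
  rw [force_subst, inst_comp_assign hy]
  exact (force_congr_free φ ((agree_assign (fun _ => hφ) q).ext _)).1 ht

/-- Where the equation is forced, the two swapped substitutions yield assignments that agree on
every symbol. -/
theorem valid_eqL {x y : X} {t s : Tm L X 0}
    (h : M.Valid (substSet Γ (Sub.double x s y t)) (substSet Δ (Sub.double x s y t))) :
    M.Valid (insert (.eq t s) (substSet Γ (Sub.double x t y s))) (substSet Δ (Sub.double x t y s)) := by
  intro e p hΓ hΔ
  rw [forces_insert, forces_substSet] at hΓ
  rw [refutes_substSet] at hΔ
  have hts : M.eq p (t.subst e) (s.subst e) := hΓ.1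
  have hag : M.Agree Set.univ ((Sub.double x t y s).comp e) ((Sub.double x s y t).comp e) p := by
    refine ⟨fun z _ => ?_, fun i => i.elim0⟩
    simp only [Sub.comp, Sub.double]
    split_ifs
    · exact hts
    · exact M.eq_symm _ _ _ hts
    · exact M.eq_refl _ _
  exact h e p (forces_substSet.2 (hΓ.2.congr (hag.mono (Set.subset_univ _) le_rfl)))
    (refutes_substSet.2 (hΔ.congr (hag.mono (Set.subset_univ _) le_rfl)))

theorem valid_defR {Φ : Defn L X 0} {r : DefRule L X 0} (hr : r ∈ Φ) (s : Fin r.numVars → Tm L X 0)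
    (h : M.Valid (insert (.defn Φ) Γ) (insert (r.body.subst (Sub.inst s)).toFormula Δ)) :
    M.Valid (insert (.defn Φ) Γ) (insert (.rel r.head fun i => (r.args i).subst (Sub.inst s)) Δ) := by
  intro e p hΓ hΔ
  rw [refutes_insert] at hΔ
  have key := force_of_not_refutes hΔ.2 fun q hq => h e q (hΓ.mono hq)
  rw [force_toFormula, forceFO_subst, Sub.inst_comp] at key
  have hΦ : M.forceDefn Φ e p := (forces_insert.1 hΓ).1
  refine hΔ.1 p le_rfl ?_
  simpa only [force, Fml.force, Tm.subst_subst, Sub.inst_comp] using hΦ.1 r hr p le_rfl _ key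

/-- The minor premises say that the relations defined by `F` are closed under the rules with head in
`S`. The minimality clause of the forced definition then turns the atom into its induction
hypothesis, and the major premise applies. -/
theorem valid_defL {Φ : Defn L X 0} {S : Set (Pred L)} (hS : S ⊆ Φ.defined)
    {F : (Q : Pred L) → FO L X Q.1} {Q : Pred L} (hQ : Q ∈ S) {ts : Fin Q.1 → Tm L X 0}
    {y : (r : DefRule L X 0) → Fin r.numVars → X}
    (hinj : ∀ r ∈ Φ, r.head ∈ S → Function.Injective (y r))
    (hfresh : ∀ r ∈ Φ, r.head ∈ S → ∀ i,
      y r i ∉ freeSet (Γ ∪ Δ) ∧ y r i ∉ Φ.free ∧ ∀ Q ∈ S, y r i ∉ (F Q).free)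
    (hminor : ∀ r ∈ Φ, r.head ∈ S → M.Valid
      (insert ((r.body.replace S F true).subst (Sub.inst fun i => obj (y r i))).toFormula
        (insert (.defn Φ) Γ))
      (insert ((F r.head).subst (Sub.args fun j =>
        (r.args j).subst (Sub.inst fun i => obj (y r i)))).toFormula Δ))
    (hmajor : M.Valid (insert ((F Q).subst (Sub.args ts)).toFormula (insert (.defn Φ) Γ)) Δ) :
    M.Valid (insert (.rel Q ts) (insert (.defn Φ) Γ)) Δ := by
  intro e p hΓ hΔ
  rw [forces_insert, forces_insert] at hΓ
  obtain ⟨hat, hdef, hΓ⟩ := hΓ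
  have hΦ : M.forceDefn Φ e p := hdef
  refine hmajor e p (forces_insert.2 ⟨?_, forces_insert.2 ⟨hdef, hΓ⟩⟩) hΔ
  rw [force_toFormula, forceFO_subst, Sub.args_comp]
  have key := hΦ.2 S hS F (fun x => e (.inl x)) Q hQ (fun i => (ts i).subst e) p le_rfl
    ⟨?_, hat⟩
  · simpa only [update, hQ, if_true] using key
  -- Closure under a rule: its minor premise is read with the names `y r` denoting the arbitrary
  -- instance `a`.
  intro r hr hrS q hq a hbody
  simp only [update, hrS, if_true]
  have hs₁ : freeSet Γ ⊆ freeSet (Γ ∪ Δ) := fun z ⟨ψ, h, hz⟩ => ⟨ψ, .inl h, hz⟩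
  have hs₂ : freeSet Δ ⊆ freeSet (Γ ∪ Δ) := fun z ⟨ψ, h, hz⟩ => ⟨ψ, .inr h, hz⟩
  have hag := agree_assign (M := M) (e := e) (y := y r) (a := a) (fun i => (hfresh r hr hrS i).1) q
  have hagΦ := agree_assign (M := M) (e := e) (y := y r) (a := a) (fun i => (hfresh r hr hrS i).2.1) q
  have hrΦ : r.free ⊆ Φ.free := fun x hx => ⟨r, hr, hx⟩
  have hc : ∀ R ∈ S, ∀ x ∈ (F R).free, (assign e (y r) a).ext a (.inl x) = e (.inl x) :=
    fun R hR x hx => assign_of_fresh fun i hi => (hfresh r hr hrS i).2.2 R hR (hi ▸ hx)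
  have key := force_of_not_refutes ((hΔ.mono hq).congr (hag.mono hs₂ le_rfl)) fun q' hq' =>
    hminor r hr hrS _ q' (forces_insert.2 ⟨?_, forces_insert.2
      ⟨(force_congr_free (.defn Φ) (hagΦ.mono subset_rfl hq')).1 (force_mono hdef (hq'.trans hq)),
        (hΓ.mono (hq'.trans hq)).congr (hag.mono hs₁ hq')⟩⟩)
  · rw [force_toFormula, forceFO_subst, Sub.args_comp] at key
    refine (forceFO_congr M.admissible_rel M.admissible_rel _ ⟨fun x hx => ?_, fun j => ?_⟩).1 key
    · have := hc _ hrS x hx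
      simp only [Sub.ext, Sum.elim_inl] at this
      simpa only [Sum.elim_inl, this] using M.eq_refl _ _
    · simp only [Sum.elim_inr, Tm.subst_subst, inst_comp_assign (hinj r hr hrS)]
      exact ((hagΦ.ext a).symm.mono hrΦ le_rfl).tm fun x hx => .inl ⟨j, hx⟩
  · rw [force_toFormula, forceFO_subst, inst_comp_assign (hinj r hr hrS),
      forceFO_replace (c := fun x => e (.inl x)) _ _ _ _ hc]
    refine (forceFO_congr (admissible_update _ _ _) M.admissible_rel _
      ((hagΦ.ext a).mono ?_ hq')).1 ((forceFO_regular (admissible_update _ _ _) M.admissible_rel _ _).mono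
        hbody hq')
    exact fun x hx => hrΦ (.inr hx)

theorem soundness {c : Prop} (h : Derivable c Γ Δ) : M.Valid Γ Δ := by
  induction h with
  | ax h =>
    intro e p hΓ hΔ
    rcases h with ⟨φ, h₁, h₂⟩ | h | h
    · exact hΔ φ h₂ p le_rfl (hΓ φ h₁)
    · exact hΓ _ h
    · exact hΔ _ h p le_rfl trivial
  | wk h₁ h₂ _ ih =>
    intro e p hΓ hΔ
    exact ih e p (fun φ hφ => hΓ φ (h₁ hφ)) fun φ hφ => hΔ φ (h₂ hφ)
  | subst x t _ ih =>
    intro e p hΓ hΔ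
    exact ih _ p (forces_substSet.1 hΓ) (refutes_substSet.1 hΔ)
  | cut _ φ _ _ ih₁ ih₂ =>
    intro e p hΓ hΔ
    exact ih₂ e p (forces_insert.2
      ⟨force_of_not_refutes hΔ fun q hq => ih₁ e q (hΓ.mono hq), hΓ⟩) hΔ
  | negL _ ih =>
    intro e p hΓ hΔ
    rw [forces_insert] at hΓ
    exact hΓ.1 p le_rfl (force_of_not_refutes hΔ fun q hq => ih e q (hΓ.2.mono hq))
  | negR _ ih =>
    intro e p hΓ hΔ
    rw [refutes_insert] at hΔ
    exact hΔ.1 p le_rfl fun q hq hφ =>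
      ih e q (forces_insert.2 ⟨hφ, hΓ.mono hq⟩) (hΔ.2.mono hq)
  | orL _ _ ih₁ ih₂ =>
    intro e p hΓ hΔ
    rw [forces_insert] at hΓ
    obtain ⟨q, hq, h | h⟩ := hΓ.1 p le_rfl
    · exact ih₁ e q (forces_insert.2 ⟨h, hΓ.2.mono hq⟩) (hΔ.mono hq)
    · exact ih₂ e q (forces_insert.2 ⟨h, hΓ.2.mono hq⟩) (hΔ.mono hq)
  | orR _ ih =>
    intro e p hΓ hΔ
    rw [refutes_insert] at hΔ
    refine ih e p hΓ (refutes_insert.2 ⟨fun q hq h => hΔ.1 q hq ?_,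
      refutes_insert.2 ⟨fun q hq h => hΔ.1 q hq ?_, hΔ.2⟩⟩)
    · exact denseBelow_of_downward (fun _ _ hq h => h.imp (force_mono · hq) (force_mono · hq)) (.inl h)
    · exact denseBelow_of_downward (fun _ _ hq h => h.imp (force_mono · hq) (force_mono · hq)) (.inr h)
  | andL _ ih =>
    intro e p hΓ hΔ
    rw [forces_insert] at hΓ
    exact ih e p (forces_insert.2 ⟨hΓ.1.1, forces_insert.2 ⟨hΓ.1.2, hΓ.2⟩⟩) hΔ
  | andR _ _ ih₁ ih₂ =>
    intro e p hΓ hΔ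
    rw [refutes_insert] at hΔ
    exact hΔ.1 p le_rfl ⟨force_of_not_refutes hΔ.2 fun q hq => ih₁ e q (hΓ.mono hq),
      force_of_not_refutes hΔ.2 fun q hq => ih₂ e q (hΓ.mono hq)⟩
  | impL _ _ ih₁ ih₂ =>
    intro e p hΓ hΔ
    rw [forces_insert] at hΓ
    exact ih₂ e p (forces_insert.2 ⟨hΓ.1 p le_rfl
      (force_of_not_refutes hΔ fun q hq => ih₁ e q (hΓ.2.mono hq)), hΓ.2⟩) hΔ
  | impR _ ih =>
    intro e p hΓ hΔ
    rw [refutes_insert] at hΔ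
    exact hΔ.1 p le_rfl fun q hq hφ => force_of_not_refutes (hΔ.2.mono hq) fun r hr =>
      ih e r (forces_insert.2 ⟨force_mono hφ hr, hΓ.mono (hr.trans hq)⟩)
  | iffL _ _ ih₁ ih₂ =>
    intro e p hΓ hΔ
    rw [forces_insert] at hΓ
    refine ih₁ e p hΓ.2 (refutes_insert.2 ⟨fun q hq h => ?_, refutes_insert.2 ⟨fun q hq h => ?_, hΔ⟩⟩)
    · exact ih₂ e q (forces_insert.2 ⟨h, forces_insert.2 ⟨hΓ.1.1 q hq h, hΓ.2.mono hq⟩⟩) (hΔ.mono hq)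
    · exact ih₂ e q (forces_insert.2 ⟨hΓ.1.2 q hq h, forces_insert.2 ⟨h, hΓ.2.mono hq⟩⟩) (hΔ.mono hq)
  | iffR _ _ ih₁ ih₂ =>
    intro e p hΓ hΔ
    rw [refutes_insert] at hΔ
    refine hΔ.1 p le_rfl ⟨fun q hq hφ => ?_, fun q hq hφ => ?_⟩
    · exact force_of_not_refutes (hΔ.2.mono hq) fun r hr =>
        ih₁ e r (forces_insert.2 ⟨force_mono hφ hr, hΓ.mono (hr.trans hq)⟩)
    · exact force_of_not_refutes (hΔ.2.mono hq) fun r hr =>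
        ih₂ e r (forces_insert.2 ⟨force_mono hφ hr, hΓ.mono (hr.trans hq)⟩)
  | allL t _ ih =>
    intro e p hΓ hΔ
    rw [forces_insert] at hΓ
    refine ih e p (forces_insert.2 ⟨?_, hΓ.2⟩) hΔ
    rw [force_subst, Sub.inst_comp]
    exact hΓ.1 _
  | allR x hx hφ _ ih => exact valid_allR hx hφ ih
  | exL x hx hφ _ ih => exact valid_exL hx hφ ih
  | exR t _ ih =>
    intro e p hΓ hΔ
    rw [refutes_insert] at hΔ
    refine ih e p hΓ (refutes_insert.2 ⟨fun q hq h => hΔ.1 q hq ?_, hΔ.2⟩)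
    rw [force_subst, Sub.inst_comp] at h
    exact denseBelow_of_downward (fun _ _ hq ⟨t, h⟩ => ⟨t, force_mono h hq⟩) ⟨_, h⟩
  | eqL x y _ t s _ ih => exact valid_eqL ih
  | eqR t =>
    intro e p hΓ hΔ
    rw [refutes_insert] at hΔ
    exact hΔ.1 p le_rfl (M.eq_refl _ _)
  | defR Φ r hr s _ ih => exact valid_defR hr s ih
  | defL Φ S hS F Q hQ ts y hinj hfresh _ _ ih₁ ih₂ => exact valid_defL hS hQ hinj hfresh ih₁ ih₂

end ForcingModel

/-! ## Cut-free proofs of regular sequents -/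

section CutFree

variable {n : ℕ} (Φ : Fin n → Defn L X 0)

/-- The regular sequent with first-order parts `G` and `D` and the definitions `Φ` is provable
without cut. -/
def CF (G D : Set (FO L X 0)) : Prop := CutFreeProvable (antecedent G Φ) (succedent D)

variable {Φ} {G D : Set (FO L X 0)} {φ ψ : FO L X 0}

theorem antecedent_insert : antecedent (insert φ G) Φ = insert φ.toFormula (antecedent G Φ) := by
  simp [antecedent, Set.image_insert_eq, Set.insert_union]

theorem succedent_insert : succedent (insert φ D) = insert φ.toFormula (succedent D) := by
  simp [succedent, Set.image_insert_eq]

theorem toFormula_mem_antecedent (h : φ ∈ G) : φ.toFormula ∈ antecedent G Φ := .inl ⟨φ, h, rfl⟩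

theorem toFormula_mem_succedent (h : φ ∈ D) : φ.toFormula ∈ succedent D := ⟨φ, h, rfl⟩

theorem defn_mem_antecedent (i : Fin n) : .defn (Φ i) ∈ antecedent G Φ := .inr ⟨i, rfl⟩

theorem finite_antecedent (h : G.Finite) : (antecedent G Φ).Finite :=
  (h.image _).union (Set.finite_range _)

theorem finite_succedent (h : D.Finite) : (succedent D).Finite := h.image _

theorem CF.mono {G' D' : Set (FO L X 0)} (h : CF Φ G D) (hG : G ⊆ G') (hD : D ⊆ D') : CF Φ G' D' :=
  .wk (Set.union_subset_union_left _ (Set.image_mono hG)) (Set.image_mono hD) h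

theorem cf_ax (h₁ : φ ∈ G) (h₂ : φ ∈ D) : CF Φ G D :=
  .ax (.inl ⟨_, toFormula_mem_antecedent h₁, toFormula_mem_succedent h₂⟩)

theorem cf_bot (h : .bot ∈ G) : CF Φ G D := .ax (.inr (.inl (toFormula_mem_antecedent h)))

theorem cf_top (h : .top ∈ D) : CF Φ G D := .ax (.inr (.inr (toFormula_mem_succedent h)))

/-- Sides of sequents are sets, so a principal formula already present is absorbed. The rules below
thus read as backward rules that keep their principal formula, and conditions only ever grow. -/
theorem derivable_left {Δ : Set (Formula L X 0)} (hm : φ ∈ G)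
    (h : Derivable False (insert φ.toFormula (antecedent G Φ)) Δ) : Derivable False (antecedent G Φ) Δ := by
  rwa [Set.insert_eq_of_mem (toFormula_mem_antecedent hm)] at h

theorem derivable_right {Γ : Set (Formula L X 0)} (hm : φ ∈ D)
    (h : Derivable False Γ (insert φ.toFormula (succedent D))) : Derivable False Γ (succedent D) := by
  rwa [Set.insert_eq_of_mem (toFormula_mem_succedent hm)] at h

theorem cf_negL (hm : φ.neg ∈ G) (h : CF Φ G (insert φ D)) : CF Φ G D := by
  rw [CF, succedent_insert] at h
  exact derivable_left hm (.negL h)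

theorem cf_negR (hm : φ.neg ∈ D) (h : CF Φ (insert φ G) D) : CF Φ G D := by
  rw [CF, antecedent_insert] at h
  exact derivable_right hm (.negR h)

theorem cf_orL (hm : φ.or ψ ∈ G) (h₁ : CF Φ (insert φ G) D) (h₂ : CF Φ (insert ψ G) D) :
    CF Φ G D := by
  rw [CF, antecedent_insert] at h₁ h₂
  exact derivable_left hm (.orL h₁ h₂)

theorem cf_orR (hm : φ.or ψ ∈ D) (h : CF Φ G (insert φ (insert ψ D))) : CF Φ G D := by
  rw [CF, succedent_insert, succedent_insert] at h
  exact derivable_right hm (.orR h)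

theorem cf_andL (hm : φ.and ψ ∈ G) (h : CF Φ (insert φ (insert ψ G)) D) : CF Φ G D := by
  rw [CF, antecedent_insert, antecedent_insert] at h
  exact derivable_left hm (.andL h)

theorem cf_andR (hm : φ.and ψ ∈ D) (h₁ : CF Φ G (insert φ D)) (h₂ : CF Φ G (insert ψ D)) :
    CF Φ G D := by
  rw [CF, succedent_insert] at h₁ h₂
  exact derivable_right hm (.andR h₁ h₂)

theorem cf_impL (hm : φ.imp ψ ∈ G) (h₁ : CF Φ G (insert φ D)) (h₂ : CF Φ (insert ψ G) D) :
    CF Φ G D := by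
  rw [CF, succedent_insert] at h₁
  rw [CF, antecedent_insert] at h₂
  exact derivable_left hm (.impL h₁ h₂)

theorem cf_impR (hm : φ.imp ψ ∈ D) (h : CF Φ (insert φ G) (insert ψ D)) : CF Φ G D := by
  rw [CF, antecedent_insert, succedent_insert] at h
  exact derivable_right hm (.impR h)

theorem cf_iffL (hm : φ.iff ψ ∈ G) (h₁ : CF Φ G (insert φ (insert ψ D)))
    (h₂ : CF Φ (insert φ (insert ψ G)) D) : CF Φ G D := by
  rw [CF, succedent_insert, succedent_insert] at h₁
  rw [CF, antecedent_insert, antecedent_insert] at h₂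
  exact derivable_left hm (.iffL h₁ h₂)

theorem cf_iffR (hm : φ.iff ψ ∈ D) (h₁ : CF Φ (insert φ G) (insert ψ D))
    (h₂ : CF Φ (insert ψ G) (insert φ D)) : CF Φ G D := by
  rw [CF, antecedent_insert, succedent_insert] at h₁ h₂
  exact derivable_right hm (.iffR h₁ h₂)

theorem cf_allL {φ : FO L X (0 + 1)} (hm : .all φ ∈ G) (t : Tm L X 0)
    (h : CF Φ (insert (FO.subst φ (Sub.inst fun _ => t)) G) D) : CF Φ G D := by
  rw [CF, antecedent_insert, FO.subst_toFormula] at h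
  exact derivable_left hm (.allL t h)

theorem cf_exR {φ : FO L X (0 + 1)} (hm : .ex φ ∈ D) (t : Tm L X 0)
    (h : CF Φ G (insert (FO.subst φ (Sub.inst fun _ => t)) D)) : CF Φ G D := by
  rw [CF, succedent_insert, FO.subst_toFormula] at h
  exact derivable_right hm (.exR t h)

/-- Finitely many formulas leave some object symbol fresh. With the premise available for every
symbol, freshness need not be tracked in the truth lemma. -/
theorem cf_allR [Infinite X] (hG : G.Finite) (hD : D.Finite) {φ : FO L X (0 + 1)} (hm : .all φ ∈ D)
    (h : ∀ x, CF Φ G (insert (FO.subst φ (Sub.inst fun _ => obj x)) D)) : CF Φ G D := by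
  obtain ⟨x, hx⟩ := ((finite_freeSet ((finite_antecedent (Φ := Φ) hG).union
    (finite_succedent hD))).union (Formula.finite_free φ.toFormula.all)).exists_notMem
  specialize h x
  rw [CF, succedent_insert, FO.subst_toFormula] at h
  exact derivable_right hm (.allR x (fun h => hx (.inl h)) (fun h => hx (.inr h)) h)

theorem cf_exL [Infinite X] (hG : G.Finite) (hD : D.Finite) {φ : FO L X (0 + 1)} (hm : .ex φ ∈ G)
    (h : ∀ x, CF Φ (insert (FO.subst φ (Sub.inst fun _ => obj x)) G) D) : CF Φ G D := by
  obtain ⟨x, hx⟩ := ((finite_freeSet ((finite_antecedent (Φ := Φ) hG).union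
    (finite_succedent hD))).union (Formula.finite_free φ.toFormula.ex)).exists_notMem
  specialize h x
  rw [CF, antecedent_insert, FO.subst_toFormula] at h
  exact derivable_left hm (.exL x (fun h => hx (.inl h)) (fun h => hx (.inr h)) h)

theorem cf_defR (i : Fin n) {r : DefRule L X 0} (hr : r ∈ Φ i) (a : Fin r.numVars → Tm L X 0)
    (h : CF Φ G (insert (r.body.subst (Sub.inst a)) D)) :
    CF Φ G (insert (.rel r.head fun j => (r.args j).subst (Sub.inst a)) D) := by
  rw [CF, succedent_insert] at h ⊢
  rw [← Set.insert_eq_of_mem (defn_mem_antecedent (Φ := Φ) (G := G) i)] at h ⊢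
  exact .defR (Φ i) r hr a h

theorem exists_injective_fresh [Infinite X] {s : Set X} (hs : s.Finite) (k : ℕ) :
    ∃ y : Fin k → X, Function.Injective y ∧ ∀ i, y i ∉ s :=
  ⟨fun i => hs.infinite_compl.natEmbedding _ i,
    fun _ _ h => Fin.ext ((hs.infinite_compl.natEmbedding _).injective (Subtype.ext h)),
    fun i => (hs.infinite_compl.natEmbedding _ i).2⟩

theorem cf_defL [Infinite X] (hG : G.Finite) (hD : D.Finite) (i : Fin n)
    {S : Set (Pred L)} (hS : S ⊆ (Φ i).defined) (F : (Q : Pred L) → FO L X Q.1) {Q : Pred L} (hQ : Q ∈ S) {ts : Fin Q.1 → Tm L X 0}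
    (hm : .rel Q ts ∈ G)
    (hminor : ∀ r ∈ Φ i, r.head ∈ S → ∀ a : Fin r.numVars → Tm L X 0,
      CF Φ (insert ((r.body.replace S F true).subst (Sub.inst a)) G)
        (insert ((F r.head).subst (Sub.args fun j => (r.args j).subst (Sub.inst a))) D))
    (hmajor : CF Φ (insert ((F Q).subst (Sub.args ts)) G) D) : CF Φ G D := by
  -- The union over the finitely many rule heads includes every formula `F R` with `R ∈ S`, because
  -- `S` consists of defined predicates.
  have hfin : (freeSet (antecedent G Φ ∪ succedent D) ∪ ((Φ i).free ∪
      ⋃ r ∈ Φ i, (F r.head).free)).Finite :=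
    (finite_freeSet ((finite_antecedent hG).union (finite_succedent hD))).union
      ((Φ i).finite_free.union ((Φ i).finite_toSet.biUnion fun r _ => FO.finite_free _))
  choose y hinj hfresh using fun k => exists_injective_fresh hfin k
  have hΦ := Set.insert_eq_of_mem (defn_mem_antecedent (Φ := Φ) (G := G) i)
  apply derivable_left hm
  rw [← hΦ]
  refine Derivable.defL (Φ i) S hS F Q hQ ts (fun r => y r.numVars) (fun r _ _ => hinj _)
    (fun r _ _ j => ⟨fun h => hfresh _ j (.inl h), fun h => hfresh _ j (.inr (.inl h)), ?_⟩)
    (fun r hr hrS => ?_) ?_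
  · intro R hR h
    obtain ⟨r', hr', rfl⟩ := hS hR
    exact hfresh _ j (.inr (.inr (Set.mem_biUnion hr' h)))
  · have := hminor r hr hrS fun j => obj (y r.numVars j)
    rwa [CF, antecedent_insert, succedent_insert, ← hΦ] at this
  · rwa [CF, antecedent_insert, ← hΦ] at hmajor

end CutFree

/-! ## Equality reasoning without cut -/

/-- The congruence relation generated by the equations in `G`. -/
inductive EqClosure (G : Set (FO L X 0)) : Tm L X 0 → Tm L X 0 → Prop
  | base {t s : Tm L X 0} (h : .eq t s ∈ G) : EqClosure G t s
  | refl (t : Tm L X 0) : EqClosure G t t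
  | symm {t s : Tm L X 0} (h : EqClosure G t s) : EqClosure G s t
  | trans {t s r : Tm L X 0} (h₁ : EqClosure G t s) (h₂ : EqClosure G s r) : EqClosure G t r
  | func {k : ℕ} (f : L.Functions k) {ts ss : Fin k → Tm L X 0} (h : ∀ i, EqClosure G (ts i) (ss i)) :
      EqClosure G (.func f ts) (.func f ss)

theorem EqClosure.mono {G G' : Set (FO L X 0)} (hG : G ⊆ G') {t s : Tm L X 0} (h : EqClosure G t s) :
    EqClosure G' t s := by
  induction h with
  | base h => exact .base (hG h)
  | refl t => exact .refl t
  | symm _ ih => exact .symm ih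
  | trans _ _ ih₁ ih₂ => exact .trans ih₁ ih₂
  | func f _ ih => exact .func f ih

/-- A closed term in the scope of `k` bound object symbols. -/
def Tm.embed (k : ℕ) (t : Tm L X 0) : Tm L X k := t.subst (Sum.elim obj Fin.elim0)

theorem Tm.embed_subst {k n : ℕ} (t : Tm L X 0) (σ : Sub L X k n) :
    (t.embed k).subst σ = t.subst (Sum.elim (fun x => σ (.inl x)) Fin.elim0) := by
  rw [Tm.embed, Tm.subst_subst]
  exact Tm.subst_congr (fun i => i.elim0) fun x _ => rfl

theorem Tm.embed_args {k : ℕ} (t : Tm L X 0) (a : Fin k → Tm L X 0) :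
    (t.embed k).subst (Sub.args a) = t := by
  rw [Tm.embed_subst]
  refine Eq.trans ?_ t.subst_one
  exact Tm.subst_congr (fun i => i.elim0) fun x _ => rfl

/-- A property of formulas that is invariant under replacing one term is invariant under replacing
a tuple of terms. -/
theorem replace_tuple {C : FO L X 0 → Prop} {k : ℕ} {ts ss : Fin k → Tm L X 0}
    (h : ∀ i (ψ : FO L X 1), C (ψ.subst (Sub.args fun _ => ts i)) ↔ C (ψ.subst (Sub.args fun _ => ss i)))
    (ψ : FO L X k) : C (ψ.subst (Sub.args ts)) ↔ C (ψ.subst (Sub.args ss)) := by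
  -- The entries are exchanged one at a time, over a growing set `I` of positions.
  have key : ∀ I : Finset (Fin k), C (ψ.subst (Sub.args ts)) ↔
      C (ψ.subst (Sub.args (I.piecewise ss ts))) := by
    intro I
    induction I using Finset.induction_on with
    | empty => simp
    | insert i I hi ih =>
      rw [ih, Finset.piecewise_insert]
      set g := I.piecewise ss ts with hg
      have hgi : g = Function.update g i (ts i) := by simp [hg, hi]
      -- Freezes all entries but the `i`-th, which becomes the single bound symbol, so that the
      -- one-term hypothesis applies.
      let σ : Sub L X k 1 := Sum.elim obj (Function.update (fun j => (g j).embed 1) i (bd 0))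
      have hσ : ∀ t, (ψ.subst σ).subst (Sub.args fun _ => t) =
          ψ.subst (Sub.args (Function.update g i t)) := by
        intro t
        rw [FO.subst_subst]
        congr 1
        funext z
        rcases z with x | j
        · rfl
        · by_cases hj : j = i
          · subst hj
            simp [Sub.comp, σ, Sub.args, bd, FirstOrder.Language.Term.subst]
          · simp only [Sub.comp, σ, Sub.args, Sum.elim_inr, Function.update_of_ne hj]
            rw [Tm.embed_args]
      have := h i (ψ.subst σ)
      rwa [hσ, hσ, ← hgi] at this
  simpa using key Finset.univ

section

variable {n : ℕ} {Φ : Fin n → Defn L X 0} {G D : Set (FO L X 0)}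

/-- (=L) is applied with two symbols that are fresh for everything. Writing one of them at the
replaced position rewrites that position only and leaves the rest of the sequent alone; the equation
introduced is already on the left. -/
theorem cf_eqL [Infinite X] (hG : G.Finite) (hD : D.Finite) {t s : Tm L X 0}
    (hm : .eq t s ∈ G) (ψ : FO L X 1) :
    CF Φ G (insert (ψ.subst (Sub.args fun _ => t)) D) ↔
      CF Φ G (insert (ψ.subst (Sub.args fun _ => s)) D) := by
  obtain ⟨y, hinj, hy⟩ := exists_injective_fresh ((finite_freeSet ((finite_antecedent (Φ := Φ) hG).union
    (finite_succedent hD))).union ψ.finite_free) 2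
  have hne : y 0 ≠ y 1 := hinj.ne (by decide)
  have hfresh : ∀ a b (Γ : Set (Formula L X 0)), Γ ⊆ antecedent G Φ ∪ succedent D →
      substSet Γ (Sub.double (y 0) a (y 1) b) = Γ := by
    intro a b Γ hΓ
    refine substSet_eq_self fun x ⟨φ, hφ, hx⟩ => ?_
    have h : ∀ i, x ≠ y i := fun i hi => hy i (.inl ⟨φ, hΓ hφ, hi ▸ hx⟩)
    simp [Sub.double, h]
  have hψ : ∀ a b i, substSet (succedent (insert (ψ.subst (Sub.args fun _ => obj (y i))) D))
      (Sub.double (y 0) a (y 1) b) =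
      succedent (insert (ψ.subst (Sub.args fun _ => Sub.double (y 0) a (y 1) b (.inl (y i)))) D) := by
    intro a b i
    rw [succedent_insert, succedent_insert, substSet, Set.image_insert_eq]
    congr 1
    · rw [← FO.subst_toFormula, FO.subst_subst, Sub.args_comp]
      congr 1
      refine FO.subst_congr _ (fun x hx => ?_) fun j => rfl
      have h : ∀ i, x ≠ y i := fun i hi => hy i (.inr (hi ▸ hx))
      simp [Sub.double, Sub.args, h]
    · exact hfresh a b _ Set.subset_union_right
  have key : ∀ i, CF Φ G (insert (ψ.subst (Sub.args fun _ =>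
        Sub.double (y 0) s (y 1) t (.inl (y i)))) D) →
      CF Φ G (insert (ψ.subst (Sub.args fun _ => Sub.double (y 0) t (y 1) s (.inl (y i)))) D) := by
    intro i h
    rw [CF, ← hψ, ← hfresh s t (antecedent G Φ) Set.subset_union_left] at h
    have := Derivable.eqL _ _ hne _ _ h
    rw [hfresh _ _ _ Set.subset_union_left, hψ] at this
    exact derivable_left hm this
  constructor
  -- The rule turns `t` into `s` at the second symbol and `s` into `t` at the first, which gives the
  -- two directions.
  · simpa [Sub.double, hne.symm] using key 1
  · simpa [Sub.double] using key 0

theorem EqClosure.cf_iff [Infinite X] (hG : G.Finite) (hD : D.Finite) {t s : Tm L X 0} (h : EqClosure G t s) :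
    ∀ ψ : FO L X 1, CF Φ G (insert (ψ.subst (Sub.args fun _ => t)) D) ↔
      CF Φ G (insert (ψ.subst (Sub.args fun _ => s)) D) := by
  induction h with
  | base h => exact cf_eqL hG hD h
  | refl t => exact fun _ => Iff.rfl
  | symm _ ih => exact fun ψ => (ih ψ).symm
  | trans _ _ ih₁ ih₂ => exact fun ψ => (ih₁ ψ).trans (ih₂ ψ)
  | @func k f ts ss _ ih =>
    intro ψ
    -- The argument position of `ψ` is filled with `f` applied to `k` bound symbols, which reduces
    -- the claim to replacing the arguments of `f`.
    have := replace_tuple (C := fun φ => CF Φ G (insert φ D)) ih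
      (ψ.subst (Sum.elim obj fun _ => .func f bd))
    simp only [FO.subst_subst] at this
    have h : ∀ us : Fin k → Tm L X 0, Sub.comp (Sum.elim obj fun _ : Fin 1 => .func f bd) (Sub.args us) =
        Sub.args fun _ => .func f us := by
      intro us
      funext z
      rcases z with x | j <;> rfl
    rwa [h, h] at this

/-- The closed formula `φ` holds positively, by the facts in `G` and the rules of the definitions. -/
inductive Holds (Φ : Fin n → Defn L X 0) (G : Set (FO L X 0)) : FO L X 0 → Prop
  | top : Holds Φ G .top
  | eq {t s : Tm L X 0} (h : EqClosure G t s) : Holds Φ G (.eq t s)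
  | and {φ ψ : FO L X 0} (h₁ : Holds Φ G φ) (h₂ : Holds Φ G ψ) : Holds Φ G (.and φ ψ)
  | orl {φ ψ : FO L X 0} (h : Holds Φ G φ) : Holds Φ G (.or φ ψ)
  | orr {φ ψ : FO L X 0} (h : Holds Φ G ψ) : Holds Φ G (.or φ ψ)
  | base {Q : Pred L} {ss ts : Fin Q.1 → Tm L X 0} (h : .rel Q ss ∈ G)
      (he : ∀ j, EqClosure G (ss j) (ts j)) : Holds Φ G (.rel Q ts)
  | rule (i : Fin n) (r : DefRule L X 0) (hr : r ∈ Φ i) (a : Fin r.numVars → Tm L X 0)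
      {ts : Fin r.head.1 → Tm L X 0} (he : ∀ j, EqClosure G ((r.args j).subst (Sub.inst a)) (ts j))
      (h : Holds Φ G (r.body.subst (Sub.inst a))) : Holds Φ G (.rel r.head ts)

theorem Holds.mono {G' : Set (FO L X 0)} (hG : G ⊆ G') {φ : FO L X 0} (h : Holds Φ G φ) :
    Holds Φ G' φ := by
  induction h with
  | top => exact .top
  | eq h => exact .eq (h.mono hG)
  | and _ _ ih₁ ih₂ => exact .and ih₁ ih₂
  | orl _ ih => exact .orl ih
  | orr _ ih => exact .orr ih
  | base h he => exact .base (hG h) fun j => (he j).mono hG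
  | rule i r hr a he _ ih => exact .rule i r hr a (fun j => (he j).mono hG) ih

theorem Holds.rel_congr {Q : Pred L} {ts ss : Fin Q.1 → Tm L X 0} (h : Holds Φ G (.rel Q ts))
    (hs : ∀ j, EqClosure G (ts j) (ss j)) : Holds Φ G (.rel Q ss) := by
  cases h with
  | base h he => exact .base h fun j => (he j).trans (hs j)
  | rule i r hr a he h => exact .rule i r hr a (fun j => (he j).trans (hs j)) h

theorem cf_rel_congr [Infinite X] (hG : G.Finite) (hD : D.Finite) {Q : Pred L} {ts ss : Fin Q.1 → Tm L X 0}
    (hs : ∀ j, EqClosure G (ts j) (ss j)) (h : CF Φ G (insert (.rel Q ts) D)) :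
    CF Φ G (insert (.rel Q ss) D) :=
  (replace_tuple (C := fun φ => CF Φ G (insert φ D)) (fun j => (hs j).cf_iff hG hD) (.rel Q bd)).1 h

/-- Each clause of `Holds` is a right rule of the calculus, with (def R) for definitional rules, up
to rewriting by equations on the left. No cut is needed because rewriting is available directly on
the right side. -/
theorem Holds.cf [Infinite X] (hG : G.Finite) (hD : D.Finite) {φ : FO L X 0} (h : Holds Φ G φ) :
    CF Φ G (insert φ D) := by
  induction h with
  | top => exact cf_top (Set.mem_insert _ _)
  | @eq t s h =>
    -- Rewriting in the formula "`t` equals the bound symbol" leads from the provable `t = t` to `t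
    -- = s`.
    have := h.cf_iff (Φ := Φ) hG hD (.eq (t.embed 1) (bd 0))
    have he : ∀ u : Tm L X 0, FO.subst (.eq (t.embed 1) (bd 0)) (Sub.args fun _ => u) = .eq t u := by
      intro u
      rw [FO.subst_eq, Tm.embed_args]
      rfl
    rw [he, he] at this
    refine this.1 ?_
    rw [CF, succedent_insert]
    exact .eqR t
  | and _ _ ih₁ ih₂ =>
    refine cf_andR (Set.mem_insert _ _) (ih₁.mono subset_rfl ?_) (ih₂.mono subset_rfl ?_) <;>
      exact Set.insert_subset_insert (Set.subset_insert _ _)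
  | orl _ ih =>
    refine cf_orR (Set.mem_insert _ _) (ih.mono subset_rfl (Set.insert_subset_insert ?_))
    exact (Set.subset_insert _ _).trans (Set.subset_insert _ _)
  | orr _ ih =>
    refine cf_orR (Set.mem_insert _ _) (ih.mono subset_rfl ?_)
    exact (Set.insert_subset_insert (Set.subset_insert _ _)).trans (Set.subset_insert _ _)
  | base h he => exact cf_rel_congr hG hD he (cf_ax h (Set.mem_insert _ _))
  | rule i r hr a he _ ih => exact cf_rel_congr hG hD he (cf_defR i hr a ih)

end

/-! ## The canonical forcing model -/

/-- A finite regular sequent that is not provable without cut. -/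
structure Condition {n : ℕ} (Φ : Fin n → Defn L X 0) where
  left : Set (FO L X 0)
  right : Set (FO L X 0)
  finite_left : left.Finite
  finite_right : right.Finite
  not_cf : ¬ CF Φ left right

namespace Condition

variable {n : ℕ} {Φ : Fin n → Defn L X 0}

/-- Larger sequents are smaller (stronger) conditions. -/
instance : Preorder (Condition Φ) where
  le q p := p.left ⊆ q.left ∧ p.right ⊆ q.right
  le_refl _ := ⟨subset_rfl, subset_rfl⟩
  le_trans _ _ _ h₁ h₂ := ⟨h₂.1.trans h₁.1, h₂.2.trans h₁.2⟩

theorem exists_extension (p : Condition Φ) {A B : Set (FO L X 0)} (hA : A.Finite) (hB : B.Finite)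
    (hl : p.left ⊆ A) (hr : p.right ⊆ B) (h : ¬ CF Φ A B) : ∃ q ≤ p, q.left = A ∧ q.right = B :=
  ⟨⟨A, B, hA, hB, h⟩, ⟨hl, hr⟩, rfl, rfl⟩

theorem exists_left (p : Condition Φ) {φ : FO L X 0} (h : ¬ CF Φ (insert φ p.left) p.right) :
    ∃ q ≤ p, φ ∈ q.left := by
  obtain ⟨q, hq, hl, -⟩ := p.exists_extension (p.finite_left.insert φ) p.finite_right
    (Set.subset_insert _ _) subset_rfl h
  exact ⟨q, hq, hl ▸ Set.mem_insert _ _⟩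

theorem exists_right (p : Condition Φ) {φ : FO L X 0} (h : ¬ CF Φ p.left (insert φ p.right)) :
    ∃ q ≤ p, φ ∈ q.right := by
  obtain ⟨q, hq, -, hr⟩ := p.exists_extension p.finite_left (p.finite_right.insert φ)
    subset_rfl (Set.subset_insert _ _) h
  exact ⟨q, hq, hr ▸ Set.mem_insert _ _⟩

theorem not_holds [Infinite X] (p : Condition Φ) {φ : FO L X 0} (hφ : φ ∈ p.right) :
    ¬ Holds Φ p.left φ := fun h => p.not_cf <| by
  have := h.cf p.finite_left p.finite_right
  rwa [Set.insert_eq_of_mem hφ] at this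

end Condition

theorem DenseBelow.and {P : Type*} [Preorder P] {A B : P → Prop} {p : P} (hA : DenseBelow A p)
    (hB : DenseBelow B p) (hm : ∀ p q, q ≤ p → A p → A q) : DenseBelow (fun q => A q ∧ B q) p :=
  fun q hq =>
    let ⟨r, hr, ha⟩ := hA q hq
    let ⟨s, hs, hb⟩ := hB r (hr.trans hq)
    ⟨s, hs.trans hr, hm r s hs ha, hb⟩

/-- Arities are finite, so finitely many successive strengthenings realise all components;
monotonicity preserves those obtained earlier. -/
theorem denseBelow_forall_fin {P : Type*} [Preorder P] {p : P} : ∀ {k : ℕ} {A : Fin k → P → Prop},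
    (∀ i, DenseBelow (A i) p) → (∀ i p q, q ≤ p → A i p → A i q) → DenseBelow (fun q => ∀ i, A i q) p
  | 0, _, _, _ => fun q _ => ⟨q, le_rfl, fun i => i.elim0⟩
  | _ + 1, _, h, hm =>
    ((h 0).and (denseBelow_forall_fin (fun i => h i.succ) fun i => hm i.succ) (hm 0)).imp
      fun _ _ h => Fin.cases h.1 h.2

variable {n : ℕ} {Φ : Fin n → Defn L X 0}

theorem eqClosure_downward (t s : Tm L X 0) (p q : Condition Φ) (hq : q ≤ p)
    (h : EqClosure p.left t s) : EqClosure q.left t s := h.mono hq.1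

theorem holds_downward (φ : FO L X 0) (p q : Condition Φ) (hq : q ≤ p)
    (h : Holds Φ p.left φ) : Holds Φ q.left φ := h.mono hq.1

variable (Φ) in
/-- The forcing model in which an atom is forced if it densely follows from the left sides of the
conditions, by equality reasoning and the rules of the definitions. -/
def canonicalModel : ForcingModel L X (Condition Φ) where
  eq p t s := DenseBelow (fun q => EqClosure q.left t s) p
  rel p Q ts := DenseBelow (fun q => Holds Φ q.left (.rel Q ts)) p
  eq_regular _ _ := isRegular_denseBelow _
  eq_refl _ t := fun q _ => ⟨q, le_rfl, .refl t⟩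
  eq_symm _ _ _ h := h.imp fun _ _ => .symm
  eq_trans _ t s _ h₁ h₂ := by
    exact (h₁.and h₂ (eqClosure_downward t s)).imp fun _ _ h => h.1.trans h.2
  eq_func _ _ f _ _ h := by
    exact (denseBelow_forall_fin h fun _ => eqClosure_downward _ _).imp fun _ _ h => .func f h
  rel_regular _ _ := isRegular_denseBelow _
  rel_congr _ _ _ _ h₁ h₂ := by
    exact (h₂.and (denseBelow_forall_fin h₁ fun _ => eqClosure_downward _ _) (holds_downward _)).imp
      fun _ _ h => h.1.rel_congr h.2

/-! ### The truth lemma, and why the canonical model forces the definitions. -/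

namespace canonicalModel

theorem eq_of_closure {p : Condition Φ} {t s : Tm L X 0} (h : EqClosure p.left t s) :
    (canonicalModel Φ).eq p t s := denseBelow_of_downward (eqClosure_downward t s) h

theorem rel_of_holds {p : Condition Φ} {Q : Pred L} {ts} (h : Holds Φ p.left (.rel Q ts)) :
    (canonicalModel Φ).rel p Q ts := denseBelow_of_downward (holds_downward _) h

theorem regular {m : ℕ} (φ : FO L X m) (e : Sub L X m 0) :
    IsRegular ((canonicalModel Φ).forceFO (canonicalModel Φ).rel (canonicalModel Φ).rel φ e) :=
  ForcingModel.forceFO_regular (canonicalModel Φ).admissible_rel (canonicalModel Φ).admissible_rel φ e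

/-- Formulas on the left of a condition are forced by it, formulas on the right are not. -/
theorem truth [Infinite X] {m : ℕ} (φ : FO L X m) : ∀ (e : Sub L X m 0) (p : Condition Φ),
    (φ.subst e ∈ p.left →
        (canonicalModel Φ).forceFO (canonicalModel Φ).rel (canonicalModel Φ).rel φ e p) ∧
      (φ.subst e ∈ p.right →
        ¬ (canonicalModel Φ).forceFO (canonicalModel Φ).rel (canonicalModel Φ).rel φ e p) := by
  induction φ with
  | defn x => exact x.elim
  | top => exact fun e p => ⟨fun _ => trivial, fun h => (p.not_cf (cf_top h)).elim⟩
  | bot => exact fun e p => ⟨fun h => (p.not_cf (cf_bot h)).elim, fun _ h => h⟩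
  | eq t s =>
    refine fun e p => ⟨fun h => eq_of_closure (.base h), fun h hf => ?_⟩
    obtain ⟨q, hq, h'⟩ := hf p le_rfl
    exact q.not_holds (hq.2 h) (.eq h')
  | rel Q ts =>
    refine fun e p => ⟨fun h => rel_of_holds (.base h fun j => .refl _), fun h hf => ?_⟩
    obtain ⟨q, hq, h'⟩ := hf p le_rfl
    exact q.not_holds (hq.2 h) h'
  | neg φ ih =>
    refine fun e p => ⟨fun h q hq hf => ?_, fun h hf => ?_⟩
    -- The pattern of all cases: were the premise of the rule provable without cut, so would be `q`;
    -- hence the premise is itself a condition, to which the induction hypothesis applies.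
    · obtain ⟨r, hr, hm⟩ := q.exists_right fun hc => q.not_cf (cf_negL (hq.1 h) hc)
      exact (ih e r).2 hm ((regular φ e).mono hf hr)
    · obtain ⟨r, hr, hm⟩ := p.exists_left fun hc => p.not_cf (cf_negR h hc)
      exact hf r hr ((ih e r).1 hm)
  | and φ ψ ih₁ ih₂ =>
    refine fun e p => ⟨fun h => ⟨(regular φ e p).2 fun q hq => ?_, (regular ψ e p).2 fun q hq => ?_⟩,
      fun h hf => ?_⟩
    · obtain ⟨r, hr, hm⟩ := q.exists_left (φ := FO.subst φ e) fun hc => q.not_cf (cf_andL (hq.1 h)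
        (hc.mono (Set.insert_subset_insert (Set.subset_insert _ _)) subset_rfl))
      exact ⟨r, hr, (ih₁ e r).1 hm⟩
    · obtain ⟨r, hr, hm⟩ := q.exists_left (φ := FO.subst ψ e) fun hc => q.not_cf (cf_andL (hq.1 h)
        (hc.mono (Set.subset_insert _ _) subset_rfl))
      exact ⟨r, hr, (ih₂ e r).1 hm⟩
    · refine p.not_cf (cf_andR h ?_ ?_) <;> by_contra hc <;> obtain ⟨r, hr, hm⟩ := p.exists_right hc
      · exact (ih₁ e r).2 hm ((regular φ e).mono hf.1 hr)
      · exact (ih₂ e r).2 hm ((regular ψ e).mono hf.2 hr)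
  | or φ ψ ih₁ ih₂ =>
    refine fun e p => ⟨fun h q hq => ?_, fun h hf => ?_⟩
    · by_contra! hn
      refine q.not_cf (cf_orL (hq.1 h) ?_ ?_) <;> by_contra hc <;> obtain ⟨r, hr, hm⟩ := q.exists_left hc
      · exact (hn r hr).1 ((ih₁ e r).1 hm)
      · exact (hn r hr).2 ((ih₂ e r).1 hm)
    · obtain ⟨q, hq, hf⟩ := hf p le_rfl
      rcases hf with hf | hf
      · obtain ⟨r, hr, hm⟩ := q.exists_right (φ := FO.subst φ e) fun hc => q.not_cf (cf_orR (hq.2 h)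
          (hc.mono subset_rfl (Set.insert_subset_insert (Set.subset_insert _ _))))
        exact (ih₁ e r).2 hm ((regular φ e).mono hf hr)
      · obtain ⟨r, hr, hm⟩ := q.exists_right (φ := FO.subst ψ e) fun hc => q.not_cf (cf_orR (hq.2 h)
          (hc.mono subset_rfl (Set.subset_insert _ _)))
        exact (ih₂ e r).2 hm ((regular ψ e).mono hf hr)
  | imp φ ψ ih₁ ih₂ =>
    refine fun e p => ⟨fun h q hq hφ => (regular ψ e q).2 fun q' hq' => ?_, fun h hf => ?_⟩
    · by_contra! hn
      refine q'.not_cf (cf_impL (hq.1.trans hq'.1 h) ?_ ?_) <;> by_contra hc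
      · obtain ⟨r, hr, hm⟩ := q'.exists_right hc
        exact (ih₁ e r).2 hm ((regular φ e).mono hφ (hr.trans hq'))
      · obtain ⟨r, hr, hm⟩ := q'.exists_left hc
        exact hn r hr ((ih₂ e r).1 hm)
    · obtain ⟨r, hr, hl, hm⟩ := p.exists_extension (p.finite_left.insert _) (p.finite_right.insert _)
        (Set.subset_insert _ _) (Set.subset_insert _ _) fun hc => p.not_cf (cf_impR h hc)
      exact (ih₂ e r).2 (hm ▸ Set.mem_insert _ _)
        (hf r hr ((ih₁ e r).1 (hl ▸ Set.mem_insert _ _)))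
  | iff φ ψ ih₁ ih₂ =>
    refine fun e p => ⟨fun h => ⟨fun q hq hφ => (regular ψ e q).2 fun q' hq' => ?_,
      fun q hq hψ => (regular φ e q).2 fun q' hq' => ?_⟩, fun h hf => ?_⟩
    · by_contra! hn
      refine q'.not_cf (cf_iffL (hq.1.trans hq'.1 h) ?_ ?_)
      · suffices hc : CF Φ q'.left (insert (FO.subst φ e) q'.right) from
          hc.mono subset_rfl (Set.insert_subset_insert (Set.subset_insert _ _))
        by_contra hc
        obtain ⟨r, hr, hm⟩ := q'.exists_right hc
        exact (ih₁ e r).2 hm ((regular φ e).mono hφ (hr.trans hq'))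
      · suffices hc : CF Φ (insert (FO.subst ψ e) q'.left) q'.right from
          hc.mono (Set.subset_insert _ _) subset_rfl
        by_contra hc
        obtain ⟨r, hr, hm⟩ := q'.exists_left hc
        exact hn r hr ((ih₂ e r).1 hm)
    · by_contra! hn
      refine q'.not_cf (cf_iffL (hq.1.trans hq'.1 h) ?_ ?_)
      · suffices hc : CF Φ q'.left (insert (FO.subst ψ e) q'.right) from
          hc.mono subset_rfl (Set.subset_insert _ _)
        by_contra hc
        obtain ⟨r, hr, hm⟩ := q'.exists_right hc
        exact (ih₂ e r).2 hm ((regular ψ e).mono hψ (hr.trans hq'))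
      · suffices hc : CF Φ (insert (FO.subst φ e) q'.left) q'.right from
          hc.mono (Set.insert_subset_insert (Set.subset_insert _ _)) subset_rfl
        by_contra hc
        obtain ⟨r, hr, hm⟩ := q'.exists_left hc
        exact hn r hr ((ih₁ e r).1 hm)
    · refine p.not_cf (cf_iffR h ?_ ?_) <;> by_contra hc <;>
        obtain ⟨r, hr, hl, hm⟩ := p.exists_extension (p.finite_left.insert _)
          (p.finite_right.insert _) (Set.subset_insert _ _) (Set.subset_insert _ _) hc
      · exact (ih₂ e r).2 (hm ▸ Set.mem_insert _ _)
          (hf.1 r hr ((ih₁ e r).1 (hl ▸ Set.mem_insert _ _)))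
      · exact (ih₁ e r).2 (hm ▸ Set.mem_insert _ _)
          (hf.2 r hr ((ih₂ e r).1 (hl ▸ Set.mem_insert _ _)))
  | @all m φ ih =>
    have hs : ∀ (e : Sub L X m 0) t, (FO.subst φ (e.lift 1)).subst (Sub.inst fun _ => t) =
        FO.subst φ (e.ext fun _ => t) := fun e t => by rw [FO.subst_subst, Sub.lift_comp_inst]
    refine fun e p => ⟨fun h t => (regular φ _ p).2 fun q hq => ?_, fun h hf => ?_⟩
    · obtain ⟨r, hr, hm⟩ := q.exists_left fun hc => q.not_cf (cf_allL (hq.1 h) t hc)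
      exact ⟨r, hr, (ih _ r).1 (hs e t ▸ hm)⟩
    -- Object symbols belong to the domain, so a forced universal formula covers the instance at the
    -- eigenvariable.
    · refine p.not_cf (cf_allR p.finite_left p.finite_right h fun x => ?_)
      by_contra hc
      obtain ⟨r, hr, hm⟩ := p.exists_right hc
      exact (ih _ r).2 (hs e _ ▸ hm) ((regular φ _).mono (hf _) hr)
  | @ex m φ ih =>
    have hs : ∀ (e : Sub L X m 0) t, (FO.subst φ (e.lift 1)).subst (Sub.inst fun _ => t) =
        FO.subst φ (e.ext fun _ => t) := fun e t => by rw [FO.subst_subst, Sub.lift_comp_inst]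
    refine fun e p => ⟨fun h q hq => ?_, fun h hf => ?_⟩
    · by_contra! hn
      refine q.not_cf (cf_exL q.finite_left q.finite_right (hq.1 h) fun x => ?_)
      by_contra hc
      obtain ⟨r, hr, hm⟩ := q.exists_left hc
      exact hn r hr _ ((ih _ r).1 (hs e _ ▸ hm))
    · obtain ⟨q, hq, t, hf⟩ := hf p le_rfl
      obtain ⟨r, hr, hm⟩ := q.exists_right fun hc => q.not_cf (cf_exR (hq.2 h) t hc)
      exact (ih _ r).2 (hs e t ▸ hm) ((regular φ _).mono hf hr)

/-- A forced formula without negation holds densely. -/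
theorem denseBelow_holds {m : ℕ} {φ : FO L X m} (hl : FO.IsLiteralCombination φ) (hn : φ.NegFree)
    (e : Sub L X m 0) (p : Condition Φ)
    (h : (canonicalModel Φ).forceFO (canonicalModel Φ).rel (canonicalModel Φ).rel φ e p) :
    DenseBelow (fun q => Holds Φ q.left (φ.subst e)) p := by
  induction hl generalizing p with
  | atom ha =>
    cases ha with
    | top => exact denseBelow_of_downward (holds_downward _) .top
    | bot => exact h.elim
    | eq t s => exact DenseBelow.imp h fun _ _ => .eq
    | rel Q ts => exact h
  -- `Holds` has no clause for negations; this case is excluded by the absence of negation in rule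
  -- bodies.
  | negAtom => exact hn.elim
  | and _ _ ih₁ ih₂ =>
    exact ((ih₁ hn.1 p h.1).and (ih₂ hn.2 p h.2) (holds_downward _)).imp fun _ _ h => .and h.1 h.2
  | or _ _ ih₁ ih₂ =>
    intro q hq
    obtain ⟨r, hr, h | h⟩ := h q hq
    · obtain ⟨s, hs, h⟩ := ih₁ hn.1 r h r le_rfl
      exact ⟨s, hs.trans hr, .orl h⟩
    · obtain ⟨s, hs, h⟩ := ih₂ hn.2 r h r le_rfl
      exact ⟨s, hs.trans hr, .orr h⟩

/-- The formulas `F` with their free object symbols replaced according to `c`. -/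
def closeUnder (F : (Q : Pred L) → FO L X Q.1) (c : X → Tm L X 0) (Q : Pred L) : FO L X Q.1 :=
  (F Q).subst (Sum.elim (fun x => (c x).embed Q.1) bd)

theorem closeUnder_comp (c : X → Tm L X 0) {k : ℕ} (ts : Fin k → Tm L X 0) :
    Sub.comp (Sum.elim (fun x => (c x).embed k) bd) (Sub.args ts) = Sum.elim c ts := by
  funext z
  rcases z with x | j
  · exact Tm.embed_args _ _
  · rfl

theorem closeUnder_subst (F : (Q : Pred L) → FO L X Q.1) (c : X → Tm L X 0) (Q : Pred L)
    (ts : Fin Q.1 → Tm L X 0) :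
    (closeUnder F c Q).subst (Sub.args ts) = (F Q).subst (Sum.elim c ts) := by
  rw [closeUnder, FO.subst_subst, closeUnder_comp]

/-- The parameters chosen by `c` move from the assignment into the formulas. (def L) can then be
applied to formulas that already contain these parameters as terms. -/
theorem update_closeUnder (S : Set (Pred L)) (F : (Q : Pred L) → FO L X Q.1) (c : X → Tm L X 0) :
    (canonicalModel Φ).update S (closeUnder F c) obj = (canonicalModel Φ).update S F c := by
  funext p Q ts
  have h : (Sum.elim obj ts : Sub L X Q.1 0) = Sub.args ts := by
    funext z
    rcases z with x | j <;> rfl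
  simp only [ForcingModel.update, closeUnder, h, ForcingModel.forceFO_subst, closeUnder_comp]

/-- An atom on the left side of a condition satisfies every family of definable relations that is
closed under the rules of the definition. -/
theorem update_of_mem [Infinite X] {i : Fin n} {S : Set (Pred L)} (hS : S ⊆ (Φ i).defined)
    {F : (Q : Pred L) → FO L X Q.1} {c : X → Tm L X 0} {p : Condition Φ}
    (hcl : ∀ r ∈ Φ i, r.head ∈ S →
      (canonicalModel Φ).RuleClosed r ((canonicalModel Φ).update S F c)
        ((canonicalModel Φ).update S F c) (Sub.one L X 0) p)
    {Q : Pred L} (hQ : Q ∈ S) {ts : Fin Q.1 → Tm L X 0} (hm : .rel Q ts ∈ p.left) :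
    (canonicalModel Φ).update S F c p Q ts := by
  refine ((ForcingModel.admissible_update S F c).regular Q ts p).2 fun q hq => ?_
  by_contra! hn
  -- It remains to prove all premises of the induction rule without cut. An unprovable one would
  -- give a condition violating either closure (minor premise) or the choice of `q` (major premise).
  refine q.not_cf (cf_defL q.finite_left q.finite_right i hS (closeUnder F c) hQ (hq.1 hm) ?_ ?_)
  · intro r hr hrS a
    by_contra hc
    obtain ⟨s, hs, hl, hr'⟩ := q.exists_extension (q.finite_left.insert _) (q.finite_right.insert _)
        (Set.subset_insert _ _) (Set.subset_insert _ _) hc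
    have hbody := (truth _ _ s).1 (hl ▸ Set.mem_insert _ _)
    -- The syntactic replacement in the body is read as reinterpretation of the positive
    -- occurrences, the form in which `hcl` speaks of bodies.
    rw [ForcingModel.forceFO_replace (c := obj) _ _ (Sub.inst a) _ fun _ _ _ _ => rfl, update_closeUnder,
      Sub.inst_eq_ext] at hbody
    have hhead := hcl r hr hrS s (hs.trans hq) a hbody
    simp only [ForcingModel.update, hrS, if_true] at hhead
    refine (truth _ _ s).2 ?_ hhead
    rw [hr', ← Sub.inst_eq_ext, ← closeUnder_subst]
    exact Set.mem_insert _ _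
  · by_contra hc
    obtain ⟨s, hs, hl⟩ := q.exists_left hc
    refine hn s hs ?_
    simp only [ForcingModel.update, hQ, if_true]
    rw [closeUnder_subst] at hl
    exact (truth _ _ s).1 hl

/-- Induction on the derivation, with positive occurrences read in the closed family. Initial atoms
in `S` are covered by `update_of_mem`, derived ones by the closure hypothesis; atoms outside `S`
keep their meaning in the model. -/
theorem update_of_holds [Infinite X] (hdisj : ∀ i j, i ≠ j → (Φ i).defined ∩ (Φ j).defined = ∅)
    {i : Fin n} {S : Set (Pred L)} (hS : S ⊆ (Φ i).defined)
    {F : (Q : Pred L) → FO L X Q.1} {c : X → Tm L X 0} {p : Condition Φ}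
    (hcl : ∀ r ∈ Φ i, r.head ∈ S →
      (canonicalModel Φ).RuleClosed r ((canonicalModel Φ).update S F c)
        ((canonicalModel Φ).update S F c) (Sub.one L X 0) p)
    {φ : FO L X 0} (h : Holds Φ p.left φ) :
    (canonicalModel Φ).forceFO ((canonicalModel Φ).update S F c) (canonicalModel Φ).rel φ
      (Sub.one L X 0) p := by
  have hone : ∀ {Q : Pred L} {ts : Fin Q.1 → Tm L X 0}, (canonicalModel Φ).update S F c p Q ts →
      (canonicalModel Φ).forceFO ((canonicalModel Φ).update S F c) (canonicalModel Φ).rel (.rel Q ts)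
        (Sub.one L X 0) p := by
    intro Q ts h
    simpa only [ForcingModel.forceFO, Fml.force, Tm.subst_one] using h
  have hreg := fun φ : FO L X 0 => ForcingModel.forceFO_regular
    (ForcingModel.admissible_update (M := canonicalModel Φ) S F c) (canonicalModel Φ).admissible_rel
    φ (Sub.one L X 0)
  induction h with
  | top => trivial
  | eq h =>
    simp only [ForcingModel.forceFO, Fml.force, Tm.subst_one]
    exact eq_of_closure h
  | and _ _ ih₁ ih₂ => exact ⟨ih₁, ih₂⟩
  | orl _ ih =>
    exact denseBelow_of_downward (fun _ _ hq h => h.imp ((hreg _).mono · hq) ((hreg _).mono · hq))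
      (.inl ih)
  | orr _ ih =>
    exact denseBelow_of_downward (fun _ _ hq h => h.imp ((hreg _).mono · hq) ((hreg _).mono · hq))
      (.inr ih)
  | @base Q ss ts h he =>
    refine hone ?_
    by_cases hQ : Q ∈ S
    · exact (ForcingModel.admissible_update S F c).congr _ _ _ _ (fun j => eq_of_closure (he j))
        (update_of_mem hS hcl hQ h)
    · simp only [ForcingModel.update, hQ, if_false]
      exact rel_of_holds (.base h he)
  | rule j r hr a he h ih =>
    refine hone ?_
    by_cases hQ : r.head ∈ S
    -- A predicate of `S` is defined by `Φ i` alone, so the last rule belongs to `Φ i` and the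
    -- closure hypothesis covers it.
    · have hij : i = j := by
        by_contra hij
        have : r.head ∈ (Φ i).defined ∩ (Φ j).defined := ⟨hS hQ, r, hr, rfl⟩
        rwa [hdisj i j hij] at this
      subst hij
      rw [ForcingModel.forceFO_subst] at ih
      have hc : (Sub.inst a).comp (Sub.one L X 0) = (Sub.one L X 0).ext a := by
        simp only [Sub.inst_comp, Tm.subst_one]
      rw [hc] at ih
      refine (ForcingModel.admissible_update S F c).congr _ _ _ _ (fun k => ?_)
        (hcl r hr hQ p le_rfl a ih)
      rw [← Sub.inst_eq_ext]
      exact eq_of_closure (he k)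
    · simp only [ForcingModel.update, hQ, if_false]
      exact rel_of_holds (.rule j r hr a he h)

/-- Closure holds since a forced body is densely derivable, hence so is the head. For minimality, a
forced atom is densely derivable, each derivation places it in the closed family at that condition,
and regularity brings this back to the original one. -/
theorem forceDefn [Infinite X] (hdisj : ∀ i j, i ≠ j → (Φ i).defined ∩ (Φ j).defined = ∅)
    (hbody : ∀ i, ∀ r ∈ Φ i, FO.IsLiteralCombination r.body) (hneg : ∀ i, ∀ r ∈ Φ i, r.body.NegFree)
    (i : Fin n) (p : Condition Φ) : (canonicalModel Φ).forceDefn (Φ i) (Sub.one L X 0) p := by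
  refine ⟨fun r hr q _ a h => ?_, fun S hS F c Q hQ ts q _ ⟨hcl, h⟩ => ?_⟩
  · rw [← Sub.inst_eq_ext] at h ⊢
    exact (denseBelow_holds (hbody i r hr) (hneg i r hr) _ q h).imp fun s _ hs =>
      .rule i r hr a (fun _ => .refl _) hs
  · refine ((ForcingModel.admissible_update S F c).regular Q ts q).2 fun q' hq' => ?_
    obtain ⟨r, hr, h⟩ := h q' hq'
    refine ⟨r, hr, ?_⟩
    have := update_of_holds hdisj hS (fun r' h₁ h₂ => (hcl r' h₁ h₂).mono (hr.trans hq')) h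
    simpa only [ForcingModel.forceFO, Fml.force, Tm.subst_one] using this

end canonicalModel

end FOID

/-! ### Cut elimination. -/

theorem mainTheorem6 {L : FirstOrder.Language.{u, v}} {X : Type w} [Infinite X] {n : ℕ}
    (Γ : Set (FOID.FO L X 0)) (Φ : Fin n → FOID.Defn L X 0) (Δ : Set (FOID.FO L X 0))
    (hcan : FOID.IsCanonical Γ Φ Δ)
    (hneg : ∀ i, ∀ r ∈ Φ i, FOID.FO.NegFree r.body)
    (hprov : FOID.Provable (FOID.antecedent Γ Φ) (FOID.succedent Δ)) :
    FOID.CutFreeProvable (FOID.antecedent Γ Φ) (FOID.succedent Δ) := by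
  by_contra hcf
  -- The unprovable sequent is itself a condition; with every symbol denoting itself, it forces its
  -- left side and refutes its right side.
  let p : FOID.Condition Φ := ⟨Γ, Δ, hcan.finite_left, hcan.finite_right, hcf⟩
  refine FOID.ForcingModel.soundness (M := FOID.canonicalModel Φ) hprov (FOID.Sub.one L X 0) p ?_ ?_
  · rintro _ (⟨φ, hφ, rfl⟩ | ⟨i, rfl⟩)
    · rw [FOID.ForcingModel.force_toFormula]
      exact (FOID.canonicalModel.truth φ _ p).1 ((FOID.FO.subst_one φ).symm ▸ hφ)
    · exact FOID.canonicalModel.forceDefn hcan.defined_disjoint hcan.body hneg i p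
  · rintro _ ⟨φ, hφ, rfl⟩ q hq
    rw [FOID.ForcingModel.force_toFormula]
    -- Formulas on the right persist to every stronger `q`, so they are refuted and not merely
    -- unforced at `p`.
    exact (FOID.canonicalModel.truth φ _ q).2 (hq.2 ((FOID.FO.subst_one φ).symm ▸ hφ))
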